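/- Let $A>0$ (peak power), $\mathcal E>0$ (average power), $\beta>0$, let $M\ge 1$ be an integer (number of users), and suppose $\mathcal E/A\in(0,\tfrac13]$. All logarithms are natural. The coherent optical CDMA channel takes an input $X\ge 0$ with mean $\eta=\mathbb E[X]$ and outputs $Y\in\{0,1,2,\dots\}$ with the Laguerre law with signal power $x/M$ and input-dependent noise power $\beta\eta$, $$W(y|x)=\frac{e^{-\frac{x}{M\beta\eta}}}{1+\beta\eta}\Big(\frac{\beta\eta}{1+\beta\eta}\Big)^{y}\sum_{j=0}^{\infty}\Big(\frac{x}{M\beta\eta(1+\beta\eta)}\Big)^{j}\frac{(y+j)!}{(j!)^2\,y!}$$ (if $\eta=0$, then $X=0$ and $Y=0$ almost surely). Let $\mathcal C(A,\mathcal E)=\sup I(X;Y)$ (in nats), where the supremum is over all laws of $X$ on $[0,\infty)$ with $\Pr[X\ge A]=0$ and $\mathbb E[X]\le\mathcal E$. For every $\alpha\in(0,\mathcal E/A]$ there is exactly one $\mu=\mu(\alpha)\ge 0$ such that the probability density on $[0,A]$ proportional to $x^{-1/2}e^{-\mu x/A}$ has mean $\alpha A$ (for $\alpha<\tfrac13$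 it is the positive solution of $\frac1{2\mu}-\frac{e^{-\mu}}{\sqrt{\pi\mu}\,\mathrm{erf}(\sqrt\mu)}=\alpha$, and $\mu(\tfrac13)=0$). For $P>0$ put $$\kappa(P)=\frac{M\left(12\beta P(\beta P+1)+1\right)}{12A(2\beta P+1)}$$ and $$\begin{aligned}B(\alpha,P)={}&\tfrac12\log A-(1-\alpha)\mu-\log\big(\tfrac12-\alpha\mu\big)\\&-e^{\mu}\big(\tfrac12-\alpha\mu\big)\Big[2\sqrt{\kappa(P)}\arctan\frac1{\sqrt{\kappa(P)}}+\log\big(1+\kappa(P)\big)\Big]\\&+\log\Big(\frac1M+\frac{1+\beta P}{P}\Big)-\tfrac12\log(2\pi e)-1-\tfrac12\log\frac{2\beta P+1}{M}\\&+\Big(\frac PM+\beta P\Big)\log\Big(1+\frac1{\frac PM+\beta P}\Big),\end{aligned}$$ where $\mu=\mu(\alpha)$. Then $$\mathcal C(A,\mathcal E)\ \ge\ \max_{0<\alpha\le \mathcal E/A}B(\alpha,\mathcal E)\qquad\text{and}\qquad \mathcal C(A,\mathcal E)\ \ge\ \max_{0<\alpha\le \mathcal E/A}B(\alpha,\alpha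 A),$$ and both maxima are attained. -/

import Mathlib

open MeasureTheory ProbabilityTheory Set
open scoped NNReal ENNReal

namespace OpticalCDMA

noncomputable section

/-- The Laguerre probability mass function `y ↦ W(y)` with signal power `x` and noise power `lam`
(meant for `lam > 0`; at `lam = 0` the expression evaluates to the point mass at `y = 0`, which is
only ever used for the signal `x = 0`). -/
def laguerrePMF (lam x : ℝ) (y : ℕ) : ℝ :=
  Real.exp (-x / lam) / (1 + lam) * (lam / (1 + lam)) ^ y *
    ∑' j : ℕ, (x / (lam * (1 + lam))) ^ j *
      (((y + j).factorial : ℝ) / ((j.factorial : ℝ) ^ 2 * (y.factorial : ℝ)))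

/-- The Laguerre law on the photon counts `ℕ`. -/
def laguerreMeasure (lam x : ℝ≥0) : Measure ℕ :=
  Measure.sum fun y : ℕ => ENNReal.ofReal (laguerrePMF lam x y) • Measure.dirac y

/-- Terms of the Laguerre series, as a double array in `(y, j)`. -/
def laguerreTerm (lam x : ℝ) (y j : ℕ) : ℝ :=
  Real.exp (-x / lam) / (1 + lam) * (lam / (1 + lam)) ^ y *
    ((x / (lam * (1 + lam))) ^ j *
      (((y + j).factorial : ℝ) / ((j.factorial : ℝ) ^ 2 * (y.factorial : ℝ))))

theorem factorial_ratio (y j : ℕ) :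
    ((y + j).factorial : ℝ) / ((j.factorial : ℝ) ^ 2 * (y.factorial : ℝ))
      = ((y + j).choose j : ℝ) / (j.factorial : ℝ) := by
  have h := Nat.add_choose_mul_factorial_mul_factorial y j
  have h' : ((y + j).choose j : ℝ) * y.factorial * j.factorial = (y + j).factorial := by
    exact_mod_cast h
  have hy : (y.factorial : ℝ) ≠ 0 := by positivity
  have hj : (j.factorial : ℝ) ≠ 0 := by positivity
  rw [← h']
  field_simp

theorem laguerreTerm_nonneg (lam x : ℝ≥0) (y j : ℕ) : 0 ≤ laguerreTerm lam x y j := by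
  unfold laguerreTerm
  positivity

theorem summable_laguerreTerm (lam x : ℝ≥0) (y : ℕ) :
    Summable (laguerreTerm lam x y) := by
  unfold laguerreTerm
  refine Summable.mul_left _ ?_
  set r : ℝ := (x : ℝ) / (lam * (1 + lam)) with hr
  have hr0 : 0 ≤ r := by positivity
  refine Summable.of_nonneg_of_le (fun j => by positivity) (fun j => ?_)
    ((Real.summable_pow_div_factorial (2 * r)).mul_left (2 ^ y))
  rw [factorial_ratio]
  have h : ((y + j).choose j : ℝ) ≤ 2 ^ (y + j) := by
    exact_mod_cast Nat.choose_le_two_pow (y + j) j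
  calc r ^ j * (((y + j).choose j : ℝ) / (j.factorial : ℝ))
      ≤ r ^ j * ((2 ^ (y + j) : ℝ) / (j.factorial : ℝ)) := by gcongr
    _ = 2 ^ y * ((2 * r) ^ j / (j.factorial : ℝ)) := by rw [pow_add, mul_pow]; ring

theorem ofReal_laguerrePMF (lam x : ℝ≥0) (y : ℕ) :
    ENNReal.ofReal (laguerrePMF lam x y)
      = ∑' j : ℕ, ENNReal.ofReal (laguerreTerm lam x y j) := by
  rw [← ENNReal.ofReal_tsum_of_nonneg (laguerreTerm_nonneg lam x y) (summable_laguerreTerm lam x y)]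
  unfold laguerrePMF laguerreTerm
  rw [tsum_mul_left]

theorem measurable_laguerreMeasure (lam : ℝ≥0) : Measurable (laguerreMeasure lam) := by
  refine Measure.measurable_of_measurable_coe _ fun s hs => ?_
  simp only [laguerreMeasure, Measure.sum_apply _ hs, Measure.smul_apply, smul_eq_mul,
    ofReal_laguerrePMF]
  refine Measurable.tsum fun y => Measurable.mul_const ?_ _
  refine Measurable.tsum fun j => ENNReal.measurable_ofReal.comp ?_
  unfold laguerreTerm
  fun_prop

theorem tsum_laguerreTerm (lam x : ℝ≥0) (hlam : 0 < lam) (j : ℕ) :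
    ∑' y : ℕ, ENNReal.ofReal (laguerreTerm lam x y j)
      = ENNReal.ofReal (Real.exp (-x / lam) * ((x / lam : ℝ) ^ j / (j.factorial : ℝ))) := by
  have hl : (0 : ℝ) < lam := hlam
  have hq : ‖(lam : ℝ) / (1 + lam)‖ < 1 := by
    rw [Real.norm_of_nonneg (by positivity), div_lt_one (by positivity)]
    linarith
  have hs := hasSum_choose_mul_geometric_of_norm_lt_one j hq
  have hs2 := hs.mul_left (Real.exp (-x / lam) / (1 + lam) *
    ((x / (lam * (1 + lam)) : ℝ) ^ j / (j.factorial : ℝ)))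
  have hs3 : HasSum (fun y => laguerreTerm lam x y j)
      (Real.exp (-x / lam) * ((x / lam : ℝ) ^ j / (j.factorial : ℝ))) := by
    convert! hs2 using 1
    · funext y
      unfold laguerreTerm
      rw [factorial_ratio]
      ring
    · have h1 : 1 - (lam : ℝ) / (1 + lam) = 1 / (1 + lam) := by
        field_simp
        ring
      have hj : (j.factorial : ℝ) ≠ 0 := by positivity
      rw [h1]
      simp only [div_pow, mul_pow, one_pow]
      field_simp
      ring
  rw [← ENNReal.ofReal_tsum_of_nonneg (fun y => laguerreTerm_nonneg lam x y j) hs3.summable,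
    hs3.tsum_eq]

theorem laguerreMeasure_zero (x : ℝ≥0) : laguerreMeasure 0 x = Measure.dirac 0 := by
  have h : ∀ y : ℕ, laguerrePMF (0 : ℝ≥0) x y = if y = 0 then 1 else 0 := by
    intro y
    unfold laguerrePMF
    rw [tsum_eq_single 0 (by intro j hj; simp [hj])]
    rcases Nat.eq_zero_or_pos y with rfl | hy
    · simp
    · simp [hy.ne']
  ext s hs
  simp only [laguerreMeasure, Measure.sum_apply _ hs, h, Measure.smul_apply, smul_eq_mul]
  rw [tsum_eq_single 0 (by intro j hj; simp [hj])]
  simp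

instance isProbabilityMeasure_laguerreMeasure (lam x : ℝ≥0) :
    IsProbabilityMeasure (laguerreMeasure lam x) := by
  rcases eq_or_lt_of_le (zero_le (a := lam)) with h | hlam
  · rw [← h, laguerreMeasure_zero]
    infer_instance
  constructor
  simp only [laguerreMeasure, Measure.sum_apply _ MeasurableSet.univ, Measure.smul_apply,
    smul_eq_mul, measure_univ, mul_one, ofReal_laguerrePMF]
  rw [ENNReal.tsum_comm]
  simp only [tsum_laguerreTerm lam x hlam]
  have hs : HasSum (fun j : ℕ => Real.exp (-x / lam) * ((x / lam : ℝ) ^ j / (j.factorial : ℝ)))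
      (Real.exp (-x / lam) * Real.exp (x / lam)) := by
    refine HasSum.mul_left _ ?_
    rw [Real.exp_eq_exp_ℝ]
    exact NormedSpace.expSeries_div_hasSum_exp _
  rw [← ENNReal.ofReal_tsum_of_nonneg (fun j => by positivity) hs.summable, hs.tsum_eq,
    ← Real.exp_add]
  simp [neg_div]

/-- The coherent optical CDMA channel with `M` users and noise power `lam`: on input `x` the output
has the Laguerre law with signal power `x / M` and noise power `lam`. -/
def cdmaKernel (M : ℕ) (lam : ℝ≥0) : Kernel ℝ≥0 ℕ where
  toFun x := laguerreMeasure lam (x / M)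
  measurable' := (measurable_laguerreMeasure lam).comp (by fun_prop)

instance (M : ℕ) (lam : ℝ≥0) : IsMarkovKernel (cdmaKernel M lam) :=
  ⟨fun x => isProbabilityMeasure_laguerreMeasure lam (x / M)⟩

/-- Mean `η = E[X]` of an input law. -/
def inputMean (Q : Measure ℝ≥0) : ℝ := ∫ x : ℝ≥0, (x : ℝ) ∂Q

/-- Mutual information `I(X;Y)`, in nats, between an input of law `Q` and the output of the channel
`κ`: the Kullback-Leibler divergence of the joint law from the product of its marginals. -/
def mutualInformation (Q : Measure ℝ≥0) (κ : Kernel ℝ≥0 ℕ) : ℝ≥0∞ :=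
  InformationTheory.klDiv (Q ⊗ₘ κ) (Q.prod (κ ∘ₘ Q))

/-- Input laws on `[0, ∞)` with `Pr[X ≥ A] = 0` and `E[X] ≤ E`. -/
structure IsAdmissible (A E : ℝ) (Q : Measure ℝ≥0) : Prop where
  isProbabilityMeasure : IsProbabilityMeasure Q
  peak : Q {x : ℝ≥0 | A ≤ (x : ℝ)} = 0
  average : inputMean Q ≤ E

/-- Capacity (in nats) of the coherent optical CDMA channel under peak power `A` and average power
`E`; the noise power is `β * E[X]`, so it depends on the input law. -/
def capacity (A E β : ℝ) (M : ℕ) : ℝ≥0∞ :=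
  ⨆ (Q : Measure ℝ≥0) (_ : IsAdmissible A E Q),
    mutualInformation Q (cdmaKernel M (β * inputMean Q).toNNReal)

/-- `m ≥ 0` is the parameter for which the probability density proportional to
`x ^ (-1/2) * exp (-m * x / A)` on `[0, A]` has mean `α * A` (after the substitution `x = A * t`,
which removes `A`). For `0 < α < 1/3` this says
`1 / (2 m) - exp (-m) / (√(π m) * erf √m) = α`; for `α = 1/3` it says `m = 0`. -/
def IsTilt (α m : ℝ) : Prop :=
  0 ≤ m ∧ (∫ t in (0 : ℝ)..1, √t * Real.exp (-m * t))
    = α * ∫ t in (0 : ℝ)..1, Real.exp (-m * t) / √t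

/-- The parameter `μ = μ(α)`. -/
def tilt (α : ℝ) : ℝ := Classical.epsilon (IsTilt α)

/-- The ratio `M (12 β E (β E + 1) + 1) / (12 A (2 β E + 1))`. -/
def noiseRatio (A E β : ℝ) (M : ℕ) : ℝ :=
  M * (12 * (β * E) * (β * E + 1) + 1) / (12 * A * (2 * (β * E) + 1))

/-- The expression in the braces of the lower bound, as a function of `α` and of the average
power `E`. -/
def lowerBound (A E β : ℝ) (M : ℕ) (α : ℝ) : ℝ :=
  1 / 2 * Real.log A - (1 - α) * tilt α - Real.log (1 / 2 - α * tilt α)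
    - Real.exp (tilt α) * (1 / 2 - α * tilt α) *
      (2 * √(noiseRatio A E β M) * Real.arctan (√((noiseRatio A E β M)⁻¹))
        + Real.log (1 + noiseRatio A E β M))
    + Real.log (1 / M + (1 + β * E) / E) - 1 / 2 * Real.log (2 * Real.pi * Real.exp 1) - 1
    - 1 / 2 * Real.log ((2 * (β * E) + 1) / M)
    + (E / M + β * E) * Real.log (1 + 1 / (E / M + β * E))

end

end OpticalCDMA

/-!
# Lower bounds on the capacity of the coherent optical CDMA channel

**One input law suffices.** For `m ≥ 0` let the input have density proportional to
`x^(-1/2) exp (-m x / A)` on `(0, A)`, with mean `P = tiltMean m * A ≤ E`. It is shown that the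
mutual information is at least `lowerBound A P β M (tiltMean m)` (`ofReal_lowerBound_le_capacity`).
The tool is the Donsker-Varadhan type inequality `∫ f dμ ≤ klDiv μ ν`, valid whenever
`∫ exp f dν ≤ 1` (`ofReal_integral_le_klDiv`). It is applied to the logarithm of the ratio of the
posterior density of a reference model to the input density. In the reference model the input is
exponential with mean `P`; its output is then geometric with mean `P / M + β P`
(`lintegral_exp_laguerrePMF`), so that the posterior density is explicit. What remains of
`∫ f dμ` is the differential entropy of the input, the mean of the output, and the conditional
entropy of the output given the input (`ofReal_le_mutualInformation`).

The conditional entropy is at most that of a Gaussian of variance `Var + 1/12`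
(`entropy_le_of_variance`). The variance of the Laguerre law is computed from its representation as
a Poisson mixture of negative binomial laws (`hasSum_laguerrePMF_mul_sq`). With the weight
`x^(-1/2)` in the input density, the logarithmic term of that Gaussian bound cancels against the
input entropy up to `∫ log (1 + κ / t)`, which is estimated by dropping the exponential weight
(`setIntegral_tiltDensity_mul_log_sub_le`) and then evaluated in closed form
(`integral_log_sq_add_sub`).

**The two maxima.** The map `tiltMean` is a continuous decreasing bijection from `[0, ∞)` to `(0,
1/3]` (`tiltMean_strictAnti`, `existsUnique_isTilt`), so both bounds can be studied as functions of
`m`. At fixed power the bound is monotone in `α` (`lowerBound_mono`, from Gibbs' inequality for the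
tilted family), hence its maximum sits at `α = E / A`, where the fixed power `E` is the actual mean
of the input. When the power is `α A`, the bound is continuous in `m` and tends to `-∞` as `m → ∞`
(`exists_lowerBound_le`), so a maximum exists.

All integrals against the input law are written in the variable `u = √(x / A)`, in which the density
is smooth.
-/

namespace OpticalCDMA

/-! ### A variational bound and the entropy of integer-valued laws -/

/-- Donsker-Varadhan lower bound for the Kullback-Leibler divergence, for a test function whose
exponential moment under the second measure is at most `1`. -/
theorem ofReal_integral_le_klDiv {Ω : Type*} [MeasurableSpace Ω] {μ ν : Measure Ω}
    [IsProbabilityMeasure μ] [IsProbabilityMeasure ν] {f : Ω → ℝ} (hf : Measurable f)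
    (hfi : Integrable f μ) (hexp : ∫⁻ z, ENNReal.ofReal (Real.exp (f z)) ∂ν ≤ 1) :
    ENNReal.ofReal (∫ z, f z ∂μ) ≤ InformationTheory.klDiv μ ν := by
  by_cases hac : μ ≪ ν
  swap
  · simp [InformationTheory.klDiv_of_not_ac hac]
  by_cases hint : Integrable (llr μ ν) μ
  swap
  · simp [InformationTheory.klDiv_of_not_integrable hint]
  rw [InformationTheory.klDiv_of_ac_of_integrable hac hint]
  refine ENNReal.ofReal_le_ofReal ?_
  simp only [probReal_univ, add_sub_cancel_right]
  have hg : Measurable fun z => Real.exp (f z - llr μ ν z) :=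
    Real.measurable_exp.comp (hf.sub (measurable_llr μ ν))
  -- multiplication by `exp (-llr)` turns `μ` into the absolutely continuous part of `ν`
  have hle : ∫⁻ z, ENNReal.ofReal (Real.exp (f z - llr μ ν z)) ∂μ ≤ 1 := by
    refine le_trans ?_ hexp
    calc ∫⁻ z, ENNReal.ofReal (Real.exp (f z - llr μ ν z)) ∂μ
        ≤ ∫⁻ z, ν.rnDeriv μ z * ENNReal.ofReal (Real.exp (f z)) ∂μ := by
          refine lintegral_mono_ae ?_
          filter_upwards [exp_neg_llr hac] with z hz
          rw [sub_eq_add_neg, Real.exp_add, hz, mul_comm, ENNReal.ofReal_mul ENNReal.toReal_nonneg]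
          gcongr
          exact ENNReal.ofReal_toReal_le
      _ = ∫⁻ z, ENNReal.ofReal (Real.exp (f z)) ∂(μ.withDensity (ν.rnDeriv μ)) := by
          rw [lintegral_withDensity_eq_lintegral_mul _ (Measure.measurable_rnDeriv ν μ)
            (by fun_prop)]
          rfl
      _ ≤ ∫⁻ z, ENNReal.ofReal (Real.exp (f z)) ∂ν :=
          lintegral_mono' (Measure.withDensity_rnDeriv_le ν μ) le_rfl
  have hgi : Integrable (fun z => Real.exp (f z - llr μ ν z)) μ := by
    refine (lintegral_ofReal_ne_top_iff_integrable hg.aestronglyMeasurable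
      (ae_of_all _ fun z => (Real.exp_pos _).le)).1 ?_
    exact ne_top_of_le_ne_top ENNReal.one_ne_top hle
  have hg1 : ∫ z, Real.exp (f z - llr μ ν z) ∂μ ≤ 1 := by
    rw [integral_eq_lintegral_of_nonneg_ae (ae_of_all _ fun z => (Real.exp_pos _).le)
      hg.aestronglyMeasurable]
    exact ENNReal.toReal_le_of_le_ofReal zero_le_one (by simpa using hle)
  -- the tangent inequality `t ≤ exp t - 1`, integrated
  have hmono : ∫ z, (f z - llr μ ν z) ∂μ ≤ ∫ z, (Real.exp (f z - llr μ ν z) - 1) ∂μ := by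
    refine integral_mono (hfi.sub hint) (hgi.sub (integrable_const _)) fun z => ?_
    have := Real.add_one_le_exp (f z - llr μ ν z)
    simp only
    linarith
  rw [integral_sub hfi hint, integral_sub hgi (integrable_const _)] at hmono
  simp at hmono
  linarith

/-- Jensen's inequality for the exponential on an interval of length one; `a ^ 2 + 1 / 12` is the
mean of `t ^ 2` there. -/
theorem exp_le_integral_exp_sq (a c : ℝ) :
    Real.exp (-c * (a ^ 2 + 1 / 12)) ≤ ∫ t in (a - 1 / 2)..(a + 1 / 2), Real.exp (-c * t ^ 2) := by
  set z₀ := -c * (a ^ 2 + 1 / 12) with hz₀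
  have hpoly : ∫ t in (a - 1 / 2)..(a + 1 / 2), Real.exp z₀ * (1 + (-c * t ^ 2 - z₀))
      = Real.exp z₀ := by
    have h1 : ∫ t in (a - 1 / 2)..(a + 1 / 2), t ^ 2 = a ^ 2 + 1 / 12 := by
      rw [integral_pow]
      norm_num
      ring
    rw [intervalIntegral.integral_const_mul, intervalIntegral.integral_add (by simp)
      (Continuous.intervalIntegrable (by fun_prop) _ _), intervalIntegral.integral_sub
      (Continuous.intervalIntegrable (by fun_prop) _ _) (by simp),
      intervalIntegral.integral_const_mul, h1]
    simp
    ring_nf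
    rw [hz₀]
    ring_nf
  rw [← hpoly]
  refine intervalIntegral.integral_mono_on (by linarith)
    (Continuous.intervalIntegrable (by fun_prop) _ _)
    (Continuous.intervalIntegrable (by fun_prop) _ _) fun t _ => ?_
  have h := Real.add_one_le_exp (-c * t ^ 2 - z₀)
  calc Real.exp z₀ * (1 + (-c * t ^ 2 - z₀)) ≤ Real.exp z₀ * Real.exp (-c * t ^ 2 - z₀) := by
        gcongr
        linarith
    _ = Real.exp (-c * t ^ 2) := by
        rw [← Real.exp_add]
        congr 1
        ring

/-- A discretized Gaussian, shrunk by the factor `exp (-c / 12)`, has at most the mass of the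
continuous one. -/
theorem sum_exp_sq_le (m c : ℝ) (hc : 0 < c) (n : ℕ) :
    ∑ y ∈ Finset.range n, Real.exp (-c * (((y : ℝ) - m) ^ 2 + 1 / 12)) ≤ √(Real.pi / c) := by
  have hcont : Continuous fun t : ℝ => Real.exp (-c * t ^ 2) := by fun_prop
  calc ∑ y ∈ Finset.range n, Real.exp (-c * (((y : ℝ) - m) ^ 2 + 1 / 12))
      ≤ ∑ y ∈ Finset.range n, ∫ t in ((y : ℝ) - m - 1 / 2)..(((y + 1 : ℕ) : ℝ) - m - 1 / 2),
          Real.exp (-c * t ^ 2) := by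
        refine Finset.sum_le_sum fun y _ => ?_
        refine (exp_le_integral_exp_sq ((y : ℝ) - m) c).trans_eq ?_
        congr 1
        push_cast
        ring
    _ = ∫ t in (((0 : ℕ) : ℝ) - m - 1 / 2)..((n : ℝ) - m - 1 / 2), Real.exp (-c * t ^ 2) :=
        intervalIntegral.sum_integral_adjacent_intervals
          (a := fun y : ℕ => (y : ℝ) - m - 1 / 2) fun k _ => hcont.intervalIntegrable _ _
    _ ≤ ∫ t : ℝ, Real.exp (-c * t ^ 2) := by
        rw [intervalIntegral.integral_of_le (by
          have : (0 : ℝ) ≤ n := n.cast_nonneg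
          push_cast
          linarith)]
        exact setIntegral_le_integral (integrable_exp_neg_mul_sq hc)
          (ae_of_all _ fun t => (Real.exp_pos _).le)
    _ = √(Real.pi / c) := integral_gaussian c

/-- The entropy of a law on `ℕ` with variance `v` is at most the differential entropy of a Gaussian
of variance `v + 1 / 12`. It follows from Gibbs' inequality against the discretized Gaussian of
`sum_exp_sq_le`; the real number `m` need not be the mean. -/
theorem entropy_le_of_variance {w : ℕ → ℝ} {m v : ℝ} (hw : ∀ y, 0 < w y) (hw1 : HasSum w 1)
    (hv : HasSum (fun y : ℕ => w y * ((y : ℝ) - m) ^ 2) v) :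
    ∑' y, ENNReal.ofReal (w y * -Real.log (w y))
      ≤ ENNReal.ofReal (1 / 2 * Real.log (2 * Real.pi * Real.exp 1 * (v + 1 / 12))) := by
  have hv0 : 0 ≤ v := hv.nonneg fun y => mul_nonneg (hw y).le (sq_nonneg _)
  set s := v + 1 / 12 with hs
  have hs0 : 0 < s := by positivity
  set c := 1 / (2 * s) with hc
  have hc0 : 0 < c := by positivity
  set K := √(Real.pi / c) with hK
  have hK0 : 0 < K := by positivity
  have hlogK : Real.log K = 1 / 2 * Real.log (2 * Real.pi * s) := by
    rw [hK, Real.log_sqrt (by positivity), hc]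
    rw [show Real.pi / (1 / (2 * s)) = 2 * Real.pi * s by field_simp]
    ring
  -- `exp (-L)` is the discretized Gaussian, `L` its code length
  set L : ℕ → ℝ := fun y => Real.log K + c * (((y : ℝ) - m) ^ 2 + 1 / 12) with hL
  set p : ℕ → ℝ := fun y => Real.exp (-L y) with hp
  have hp_eq : ∀ y, p y = K⁻¹ * Real.exp (-c * (((y : ℝ) - m) ^ 2 + 1 / 12)) := by
    intro y
    simp only [hp, hL]
    rw [neg_add, Real.exp_add, Real.exp_neg, Real.exp_log hK0]
    ring_nf
  have hpsum : ∀ n, ∑ y ∈ Finset.range n, p y ≤ 1 := by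
    intro n
    simp only [hp_eq, ← Finset.mul_sum]
    calc K⁻¹ * _ ≤ K⁻¹ * K := by
          gcongr
          exact sum_exp_sq_le m c hc0 n
      _ = 1 := inv_mul_cancel₀ hK0.ne'
  have hps : Summable p := summable_of_sum_range_le (fun y => (Real.exp_pos _).le) hpsum
  have hp1 : ∑' y, p y ≤ 1 := hps.tsum_le_of_sum_range_le hpsum
  have hLsum : HasSum (fun y => w y * L y)
      (1 / 2 * Real.log (2 * Real.pi * Real.exp 1 * s)) := by
    convert! (hw1.mul_right (Real.log K + c / 12)).add (hv.mul_right c) using 1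
    · funext y
      simp only [hL]
      ring
    · rw [hlogK, show 2 * Real.pi * Real.exp 1 * s = 2 * Real.pi * s * Real.exp 1 by ring,
        Real.log_mul (by positivity) (by positivity), Real.log_exp]
      have : c * s = 1 / 2 := by rw [hc]; field_simp
      have hvs : v = s - 1 / 12 := by rw [hs]; ring
      rw [hvs]
      linear_combination (-1 : ℝ) * this
  -- `-log` is compared with its tangent: `log (p y / w y) ≤ p y / w y - 1`
  have hpt : ∀ y, w y * -Real.log (w y) ≤ w y * L y - w y + p y := by
    intro y
    have h := Real.add_one_le_exp (-L y - Real.log (w y))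
    rw [sub_eq_add_neg (-L y), Real.exp_add, Real.exp_neg (Real.log _), Real.exp_log (hw y)] at h
    have h2 := mul_le_mul_of_nonneg_left h (hw y).le
    have h3 : w y * (Real.exp (-L y) * (w y)⁻¹) = p y := by
      simp only [hp]
      field_simp [(hw y).ne']
    rw [h3] at h2
    linarith
  have hw_le : ∀ y, w y ≤ 1 := fun y => by
    simpa using le_hasSum hw1 y fun z _ => (hw z).le
  have hnn : ∀ y, 0 ≤ w y * -Real.log (w y) := fun y =>
    mul_nonneg (hw y).le (neg_nonneg.2 (Real.log_nonpos (hw y).le (hw_le y)))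
  have hR := (hLsum.sub hw1).add hps.hasSum
  have hS : Summable fun y => w y * -Real.log (w y) := Summable.of_nonneg_of_le hnn hpt hR.summable
  rw [← ENNReal.ofReal_tsum_of_nonneg hnn hS]
  refine ENNReal.ofReal_le_ofReal ?_
  have := hS.tsum_le_tsum hpt hR.summable
  rw [hR.tsum_eq] at this
  linarith

/-! ### Moments and entropy of the Laguerre law -/

theorem hasSum_laguerreTerm (lam x : ℝ≥0) (y : ℕ) :
    HasSum (laguerreTerm lam x y) (laguerrePMF lam x y) := by
  convert! (summable_laguerreTerm lam x y).hasSum using 1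
  unfold laguerrePMF laguerreTerm
  rw [tsum_mul_left]

theorem laguerrePMF_pos (lam x : ℝ≥0) (hlam : 0 < lam) (y : ℕ) : 0 < laguerrePMF lam x y := by
  have hl : (0 : ℝ) < lam := hlam
  refine lt_of_lt_of_le ?_
    (le_hasSum (hasSum_laguerreTerm lam x y) 0 fun j _ => laguerreTerm_nonneg lam x y j)
  unfold laguerreTerm
  positivity

/-- Expectations under the Laguerre law, computed by summing over the count `y` before the index `j`
of its series. -/
theorem hasSum_laguerrePMF_mul {lam x : ℝ≥0} {h : ℕ → ℝ} {g : ℕ → ℝ} {G : ℝ} (h0 : ∀ y, 0 ≤ h y)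
    (hj : ∀ j, HasSum (fun y => laguerreTerm lam x y j * h y) (g j)) (hg : HasSum g G) :
    HasSum (fun y => laguerrePMF lam x y * h y) G := by
  set F : ℕ × ℕ → ℝ := fun p => laguerreTerm lam x p.2 p.1 * h p.2 with hF
  have hF0 : 0 ≤ F := fun p => mul_nonneg (laguerreTerm_nonneg lam x _ _) (h0 _)
  have hs : Summable F := by
    refine (summable_prod_of_nonneg hF0).2 ⟨fun j => (hj j).summable, ?_⟩
    have : (fun j => ∑' y, F (j, y)) = g := funext fun j => (hj j).tsum_eq
    rw [this]
    exact hg.summable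
  have hsum : HasSum F G := by
    rw [← (hs.hasSum.prod_fiberwise hj).unique hg]
    exact hs.hasSum
  have hswap : HasSum (F ∘ Prod.swap) G := (Equiv.prodComm ℕ ℕ).hasSum_iff.2 hsum
  exact hswap.prod_fiberwise fun y => (hasSum_laguerreTerm lam x y).mul_right (h y)

/-- The Poisson weights of mean `θ`. -/
noncomputable def poissonWeight (θ : ℝ) (j : ℕ) : ℝ := Real.exp (-θ) * (θ ^ j / (j.factorial : ℝ))

theorem hasSum_poissonWeight (θ : ℝ) : HasSum (poissonWeight θ) 1 := by
  have : HasSum (fun j : ℕ => Real.exp (-θ) * (θ ^ j / (j.factorial : ℝ)))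
      (Real.exp (-θ) * Real.exp θ) := by
    refine HasSum.mul_left _ ?_
    rw [Real.exp_eq_exp_ℝ]
    exact NormedSpace.expSeries_div_hasSum_exp _
  rwa [← Real.exp_add, neg_add_cancel, Real.exp_zero] at this

theorem poissonWeight_succ (θ : ℝ) (j : ℕ) :
    poissonWeight θ (j + 1) * ((j : ℝ) + 1) = θ * poissonWeight θ j := by
  have hj : (j.factorial : ℝ) ≠ 0 := by positivity
  unfold poissonWeight
  rw [Nat.factorial_succ, pow_succ]
  push_cast
  field_simp

theorem hasSum_poissonWeight_mul (θ : ℝ) : HasSum (fun j => poissonWeight θ j * (j : ℝ)) θ := by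
  rw [← hasSum_nat_add_iff' 1]
  convert! (hasSum_poissonWeight θ).mul_left θ using 1
  · funext j
    rw [← poissonWeight_succ]
    push_cast
    ring
  · simp

theorem hasSum_poissonWeight_mul_sq (θ : ℝ) :
    HasSum (fun j => poissonWeight θ j * (j : ℝ) ^ 2) (θ ^ 2 + θ) := by
  rw [← hasSum_nat_add_iff' 1]
  convert! ((hasSum_poissonWeight_mul θ).add (hasSum_poissonWeight θ)).mul_left θ using 1
  · funext j
    rw [mul_add, ← mul_assoc, ← poissonWeight_succ]
    push_cast
    ring
  · simp
    ring

/-- For fixed `j` the terms of the Laguerre series are a Poisson weight times a negative binomial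
law in `y`. The ratio of binomial coefficients is proportional to the rising factorial
`(y + j + 1) ⋯ (y + j + k)`, so this is a rising factorial moment of the negative binomial law. -/
theorem hasSum_laguerreTerm_mul_choose (lam x : ℝ≥0) (hlam : 0 < lam) (j k : ℕ) :
    HasSum (fun y => laguerreTerm lam x y j *
        (((y + j + k).choose (j + k) : ℝ) / ((y + j).choose j : ℝ)))
      (poissonWeight (x / lam) j * (1 + lam) ^ k) := by
  have hl : (0 : ℝ) < lam := hlam
  have hq : ‖(lam : ℝ) / (1 + lam)‖ < 1 := by
    rw [Real.norm_of_nonneg (by positivity), div_lt_one (by positivity)]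
    linarith
  have hs := hasSum_choose_mul_geometric_of_norm_lt_one (j + k) hq
  convert! hs.mul_left (Real.exp (-x / lam) / (1 + lam) *
    ((x / (lam * (1 + lam)) : ℝ) ^ j / (j.factorial : ℝ))) using 1
  · funext y
    have hc : (((y + j).choose j : ℕ) : ℝ) ≠ 0 := by
      exact_mod_cast (Nat.choose_pos (by omega)).ne'
    unfold laguerreTerm
    rw [factorial_ratio, ← add_assoc]
    field_simp
  · have h1 : 1 - (lam : ℝ) / (1 + lam) = 1 / (1 + lam) := by
      field_simp
      ring
    have hj : (j.factorial : ℝ) ≠ 0 := by positivity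
    unfold poissonWeight
    rw [h1]
    simp only [div_pow, mul_pow, one_pow]
    field_simp
    ring

theorem choose_ratio_one (y j : ℕ) :
    (((y + j + 1).choose (j + 1) : ℝ) / ((y + j).choose j : ℝ)) = ((y : ℝ) + j + 1) / (j + 1) := by
  have h := Nat.add_one_mul_choose_eq (y + j) j
  have h' : ((y : ℝ) + j + 1) * ((y + j).choose j : ℝ) =
      ((y + j + 1).choose (j + 1) : ℝ) * (j + 1) := by
    exact_mod_cast h
  have hc : (((y + j).choose j : ℕ) : ℝ) ≠ 0 := by
    exact_mod_cast (Nat.choose_pos (by omega)).ne'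
  field_simp
  linarith

theorem choose_ratio_two (y j : ℕ) :
    (((y + j + 2).choose (j + 2) : ℝ) / ((y + j).choose j : ℝ))
      = ((y : ℝ) + j + 1) * (y + j + 2) / ((j + 1) * (j + 2)) := by
  have h1 := choose_ratio_one y j
  have h2 := choose_ratio_one y (j + 1)
  have hc : (((y + j).choose j : ℕ) : ℝ) ≠ 0 := by
    exact_mod_cast (Nat.choose_pos (by omega)).ne'
  have hc2 : (((y + j + 1).choose (j + 1) : ℕ) : ℝ) ≠ 0 := by
    exact_mod_cast (Nat.choose_pos (by omega)).ne'
  calc (((y + j + 2).choose (j + 2) : ℝ) / ((y + j).choose j : ℝ))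
      = (((y + (j + 1) + 1).choose (j + 1 + 1) : ℝ) / ((y + (j + 1)).choose (j + 1) : ℝ))
        * (((y + j + 1).choose (j + 1) : ℝ) / ((y + j).choose j : ℝ)) := by
        rw [← add_assoc]
        field_simp
    _ = _ := by
        rw [h1, h2]
        push_cast
        field_simp
        ring

theorem hasSum_laguerreTerm_left (lam x : ℝ≥0) (hlam : 0 < lam) (j : ℕ) :
    HasSum (fun y => laguerreTerm lam x y j) (poissonWeight (x / lam) j) := by
  convert! hasSum_laguerreTerm_mul_choose lam x hlam j 0 using 1
  · funext y
    have hc : (((y + j).choose j : ℕ) : ℝ) ≠ 0 := by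
      exact_mod_cast (Nat.choose_pos (by omega)).ne'
    simp [div_self hc]
  · simp

theorem hasSum_laguerreTerm_mul_rising (lam x : ℝ≥0) (hlam : 0 < lam) (j : ℕ) :
    HasSum (fun y => laguerreTerm lam x y j * ((y : ℝ) + j + 1))
      (poissonWeight (x / lam) j * ((j + 1) * (1 + lam))) := by
  convert! (hasSum_laguerreTerm_mul_choose lam x hlam j 1).mul_right ((j : ℝ) + 1) using 1
  · funext y
    rw [choose_ratio_one]
    field_simp
  · ring

theorem hasSum_laguerreTerm_mul_rising_two (lam x : ℝ≥0) (hlam : 0 < lam) (j : ℕ) :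
    HasSum (fun y => laguerreTerm lam x y j * (((y : ℝ) + j + 1) * (y + j + 2)))
      (poissonWeight (x / lam) j * ((j + 1) * (j + 2) * (1 + lam) ^ 2)) := by
  convert! (hasSum_laguerreTerm_mul_choose lam x hlam j 2).mul_right
    (((j : ℝ) + 1) * (j + 2)) using 1
  · funext y
    rw [choose_ratio_two]
    field_simp
  · ring

theorem hasSum_laguerrePMF (lam x : ℝ≥0) (hlam : 0 < lam) :
    HasSum (fun y => laguerrePMF lam x y) 1 := by
  simpa using hasSum_laguerrePMF_mul (h := fun _ => 1) (fun _ => zero_le_one)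
    (fun j => by simpa using hasSum_laguerreTerm_left lam x hlam j) (hasSum_poissonWeight (x / lam))

theorem hasSum_laguerrePMF_mul_id (lam x : ℝ≥0) (hlam : 0 < lam) :
    HasSum (fun y => laguerrePMF lam x y * (y : ℝ)) (x + lam) := by
  have hl : (lam : ℝ) ≠ 0 := NNReal.coe_ne_zero.2 hlam.ne'
  refine hasSum_laguerrePMF_mul (g := fun j => poissonWeight (x / lam) j * ((j + 1) * lam))
    (fun y => y.cast_nonneg) (fun j => ?_) ?_
  · convert! (hasSum_laguerreTerm_mul_rising lam x hlam j).sub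
      ((hasSum_laguerreTerm_left lam x hlam j).mul_right ((j : ℝ) + 1)) using 1
    · funext y
      ring
    · ring
  · convert! ((hasSum_poissonWeight_mul (x / lam)).add (hasSum_poissonWeight (x / lam))).mul_right
      (lam : ℝ) using 1
    · funext j
      ring
    · field_simp

/-- The variance of the Laguerre law. -/
theorem hasSum_laguerrePMF_mul_sq (lam x : ℝ≥0) (hlam : 0 < lam) :
    HasSum (fun y => laguerrePMF lam x y * ((y : ℝ) - (x + lam)) ^ 2)
      (x * (2 * lam + 1) + lam * (lam + 1)) := by
  have hl : (lam : ℝ) ≠ 0 := NNReal.coe_ne_zero.2 hlam.ne'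
  set m : ℝ := x + lam with hm
  refine hasSum_laguerrePMF_mul (g := fun j => poissonWeight (x / lam) j *
      ((j + 1) * (j + 2) * (1 + lam) ^ 2 - (2 * j + 3 + 2 * m) * ((j + 1) * (1 + lam))
        + (j + 1 + m) ^ 2))
    (fun y => sq_nonneg _) (fun j => ?_) ?_
  · convert! ((hasSum_laguerreTerm_mul_rising_two lam x hlam j).sub
      ((hasSum_laguerreTerm_mul_rising lam x hlam j).mul_right (2 * (j : ℝ) + 3 + 2 * m))).add
      ((hasSum_laguerreTerm_left lam x hlam j).mul_right (((j : ℝ) + 1 + m) ^ 2)) using 1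
    · funext y
      ring
    · ring
  · convert! (((hasSum_poissonWeight_mul_sq (x / lam)).mul_right ((lam : ℝ) ^ 2)).add
      ((hasSum_poissonWeight_mul (x / lam)).mul_right
        (3 * (1 + lam : ℝ) ^ 2 - (5 + 2 * m) * (1 + lam) + 2 * (1 + m)))).add
      ((hasSum_poissonWeight (x / lam)).mul_right
        (2 * (1 + lam : ℝ) ^ 2 - (3 + 2 * m) * (1 + lam) + (1 + m) ^ 2)) using 1
    · funext j
      ring
    · rw [hm]
      field_simp
      ring

theorem tsum_entropy_laguerrePMF_le (lam x : ℝ≥0) (hlam : 0 < lam) :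
    ∑' y, ENNReal.ofReal (laguerrePMF lam x y * -Real.log (laguerrePMF lam x y))
      ≤ ENNReal.ofReal (1 / 2 * Real.log (2 * Real.pi * Real.exp 1 *
          (x * (2 * lam + 1) + lam * (lam + 1) + 1 / 12))) :=
  entropy_le_of_variance (laguerrePMF_pos lam x hlam) (hasSum_laguerrePMF lam x hlam)
    (hasSum_laguerrePMF_mul_sq lam x hlam)

/-! ### Exponential input gives geometric output -/

theorem lintegral_pow_mul_exp_neg {b : ℝ} (hb : 0 < b) (j : ℕ) :
    ∫⁻ x in Ioi (0 : ℝ), ENNReal.ofReal (x ^ j * Real.exp (-(b * x)))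
      = ENNReal.ofReal (j.factorial / b ^ (j + 1)) := by
  have hval : ∫ x in Ioi (0 : ℝ), x ^ j * Real.exp (-(b * x)) = j.factorial / b ^ (j + 1) := by
    have h := Real.integral_rpow_mul_exp_neg_mul_Ioi (a := (j : ℝ) + 1) (r := b) (by positivity) hb
    rw [Real.Gamma_nat_eq_factorial] at h
    simp only [add_sub_cancel_right, Real.rpow_natCast] at h
    rw [h, show ((j : ℝ) + 1) = ((j + 1 : ℕ) : ℝ) by push_cast; rfl, Real.rpow_natCast]
    rw [one_div, inv_pow]
    ring
  rw [← hval, ofReal_integral_eq_lintegral_ofReal]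
  · refine Integrable.of_integral_ne_zero ?_
    rw [hval]
    positivity
  · filter_upwards [self_mem_ae_restrict measurableSet_Ioi] with x hx
    have hx0 : (0 : ℝ) < x := hx
    positivity

/-- If the signal power is exponentially distributed, then the photon count is geometric. -/
theorem lintegral_exp_laguerrePMF {M : ℕ} (hM : 1 ≤ M) {lam : ℝ≥0} (hlam : 0 < lam) {P : ℝ}
    (hP : 0 < P) (y : ℕ) :
    ∫⁻ x in Ioi (0 : ℝ), ENNReal.ofReal (P⁻¹ * Real.exp (-(x / P))) *
        ENNReal.ofReal (laguerrePMF lam (x.toNNReal / M : ℝ≥0) y)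
      = ENNReal.ofReal ((P / M + lam) ^ y / (1 + (P / M + lam)) ^ (y + 1)) := by
  have hl : (0 : ℝ) < lam := hlam
  have hM0 : (0 : ℝ) < M := by exact_mod_cast hM
  -- the two exponentials in `x` combine to `exp (-(b * x))`
  set b : ℝ := 1 / P + 1 / (M * lam) with hb
  have hb0 : 0 < b := by positivity
  set K : ℕ → ℝ := fun j => P⁻¹ * (1 / (1 + lam) * (lam / (1 + lam)) ^ y *
    ((1 / (M * (lam * (1 + lam)))) ^ j * (((y + j).choose j : ℝ) / (j.factorial : ℝ)))) with hK
  have hK0 : ∀ j, 0 ≤ K j := fun j => by positivity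
  have h1 : ∀ x ∈ Ioi (0 : ℝ), ENNReal.ofReal (P⁻¹ * Real.exp (-(x / P))) *
        ENNReal.ofReal (laguerrePMF lam (x.toNNReal / M : ℝ≥0) y)
      = ∑' j, ENNReal.ofReal (K j) * ENNReal.ofReal (x ^ j * Real.exp (-(b * x))) := by
    intro x hx
    have hx0 : 0 < x := hx
    rw [ofReal_laguerrePMF, ← ENNReal.tsum_mul_left]
    refine tsum_congr fun j => ?_
    rw [← ENNReal.ofReal_mul (by positivity), ← ENNReal.ofReal_mul (hK0 j)]
    congr 1
    have hexp : Real.exp (-(b * x)) = Real.exp (-(x / P)) * Real.exp (-(x / M) / lam) := by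
      rw [← Real.exp_add]
      congr 1
      rw [hb]
      field_simp
      ring
    unfold laguerreTerm
    rw [factorial_ratio]
    simp only [hK, NNReal.coe_div, NNReal.coe_natCast, Real.coe_toNNReal x hx0.le, hexp]
    rw [show x / M / (lam * (1 + lam)) = 1 / (M * (lam * (1 + lam))) * x by field_simp, mul_pow]
    ring
  rw [setLIntegral_congr_fun measurableSet_Ioi h1, lintegral_tsum fun j =>
    (Measurable.aemeasurable (by fun_prop))]
  have h2 : ∀ j, ∫⁻ x in Ioi (0 : ℝ),
      ENNReal.ofReal (K j) * ENNReal.ofReal (x ^ j * Real.exp (-(b * x)))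
        = ENNReal.ofReal (K j * (j.factorial / b ^ (j + 1))) := fun j => by
    rw [lintegral_const_mul _ (by fun_prop), lintegral_pow_mul_exp_neg hb0,
      ENNReal.ofReal_mul (hK0 j)]
  rw [tsum_congr h2]
  -- after integration the series in `j` is negative binomial with ratio `r`
  set r : ℝ := P / M / ((1 + lam) * (P / M + lam)) with hr
  have hr0 : 0 ≤ r := by positivity
  have h1r : 1 - r = lam * (1 + (P / M + lam)) / ((1 + lam) * (P / M + lam)) := by
    rw [hr]
    field_simp
    ring
  have hr1 : ‖r‖ < 1 := by
    rw [Real.norm_of_nonneg hr0]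
    have : 0 < 1 - r := by
      rw [h1r]
      positivity
    linarith
  have hs := (hasSum_choose_mul_geometric_of_norm_lt_one y hr1).mul_left
    (1 / (1 + lam) * (lam / (1 + lam)) ^ y * (lam / (P / M + lam)) : ℝ)
  have hbv : b = (P / M + lam) / (P * lam) := by
    rw [hb]
    field_simp
    ring
  have hs' : HasSum (fun j => K j * (j.factorial / b ^ (j + 1)))
      ((P / M + lam) ^ y / (1 + (P / M + lam)) ^ (y + 1)) := by
    convert! hs using 1
    · funext j
      have hj : (j.factorial : ℝ) ≠ 0 := by positivity
      have hc : ((j + y).choose y : ℝ) = ((y + j).choose j : ℝ) := by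
        rw [add_comm j y, Nat.choose_symm_add]
      rw [hc, hbv, hr]
      simp only [hK, div_pow, mul_pow, one_pow, pow_succ]
      field_simp
    · rw [h1r]
      set N : ℝ := P / M + lam with hN
      have hN0 : 0 < N := by positivity
      simp only [div_pow, mul_pow, pow_succ]
      field_simp
  rw [← ENNReal.ofReal_tsum_of_nonneg (fun j => by positivity) hs'.summable, hs'.tsum_eq]

/-! ### A lower bound on the mutual information -/

theorem lintegral_laguerreMeasure (lam x : ℝ≥0) (F : ℕ → ℝ≥0∞) :
    ∫⁻ y, F y ∂(laguerreMeasure lam x) = ∑' y, ENNReal.ofReal (laguerrePMF lam x y) * F y := by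
  unfold laguerreMeasure
  rw [lintegral_sum_measure]
  refine tsum_congr fun y => ?_
  rw [lintegral_smul_measure, lintegral_dirac, smul_eq_mul]

theorem measurable_laguerrePMF (lam : ℝ≥0) (y : ℕ) :
    Measurable fun x : ℝ≥0 => laguerrePMF lam x y := by
  have h : (fun x : ℝ≥0 => laguerrePMF lam x y)
      = fun x : ℝ≥0 => (∑' j, ENNReal.ofReal (laguerreTerm lam x y j)).toReal := by
    funext x
    rw [← ofReal_laguerrePMF, ENNReal.toReal_ofReal]
    exact (hasSum_laguerreTerm lam x y).nonneg fun j => laguerreTerm_nonneg lam x y j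
  rw [h]
  refine ENNReal.measurable_toReal.comp (Measurable.tsum fun j => ENNReal.measurable_ofReal.comp ?_)
  unfold laguerreTerm
  fun_prop

/-- The Gaussian upper bound on the entropy of the Laguerre law with signal power `s` and noise
power `lam`. -/
noncomputable def laguerreEntropyBound (lam s : ℝ) : ℝ :=
  1 / 2 * Real.log (2 * Real.pi * Real.exp 1 * (s * (2 * lam + 1) + lam * (lam + 1) + 1 / 12))

theorem laguerreEntropyBound_nonneg (lam s : ℝ≥0) : 0 ≤ laguerreEntropyBound lam s := by
  unfold laguerreEntropyBound
  refine mul_nonneg (by norm_num) (Real.log_nonneg ?_)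
  have h1 : (0 : ℝ) ≤ s * (2 * lam + 1) + lam * (lam + 1) := by positivity
  have h2 := Real.pi_gt_three
  have h3 := Real.exp_one_gt_d9
  have h4 : (12 : ℝ) ≤ 2 * Real.pi * Real.exp 1 := by nlinarith
  nlinarith

/-- The mean of the channel output. -/
theorem lintegral_compProd_cast {M : ℕ} {lam : ℝ≥0} (hlam : 0 < lam)
    {Q : Measure ℝ≥0} [IsProbabilityMeasure Q] (hint : Integrable (fun x : ℝ≥0 => (x : ℝ)) Q) :
    ∫⁻ z, ENNReal.ofReal (z.2 : ℝ) ∂(Q ⊗ₘ cdmaKernel M lam)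
      = ENNReal.ofReal (inputMean Q / M + lam) := by
  rw [Measure.lintegral_compProd (by fun_prop)]
  have h : ∀ x : ℝ≥0, ∫⁻ y, ENNReal.ofReal ((x, y).2 : ℝ) ∂(cdmaKernel M lam x)
      = ENNReal.ofReal (x / M + lam) := by
    intro x
    change ∫⁻ y : ℕ, ENNReal.ofReal (y : ℝ) ∂(laguerreMeasure lam (x / M)) = _
    rw [lintegral_laguerreMeasure]
    have hs := hasSum_laguerrePMF_mul_id lam (x / M) hlam
    have h0 := fun y => (laguerrePMF_pos lam (x / M) hlam y).le
    simp_rw [← ENNReal.ofReal_mul (h0 _)]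
    rw [← ENNReal.ofReal_tsum_of_nonneg (fun y => mul_nonneg (h0 y) y.cast_nonneg) hs.summable,
      hs.tsum_eq]
    simp
  simp_rw [h]
  have hi : Integrable (fun x : ℝ≥0 => (x : ℝ) / M + lam) Q :=
    (hint.div_const _).add (integrable_const _)
  rw [← ofReal_integral_eq_lintegral_ofReal hi (ae_of_all _ fun x => by positivity),
    integral_add (hint.div_const _) (integrable_const _),
    integral_div]
  simp [inputMean]

/-- The conditional entropy of the output given the input is at most the mean Gaussian bound. -/
theorem lintegral_compProd_neg_log_le {M : ℕ} {lam : ℝ≥0} (hlam : 0 < lam)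
    {Q : Measure ℝ≥0} [IsProbabilityMeasure Q]
    (hent : Integrable (fun x : ℝ≥0 => laguerreEntropyBound lam (x / M)) Q)
    (hmeas : Measurable fun z : ℝ≥0 × ℕ => Real.log (laguerrePMF lam (z.1 / M : ℝ≥0) z.2)) :
    ∫⁻ z, ENNReal.ofReal (-Real.log (laguerrePMF lam (z.1 / M : ℝ≥0) z.2))
        ∂(Q ⊗ₘ cdmaKernel M lam)
      ≤ ENNReal.ofReal (∫ x : ℝ≥0, laguerreEntropyBound lam (x / M) ∂Q) := by
  rw [Measure.lintegral_compProd (by fun_prop), ofReal_integral_eq_lintegral_ofReal hent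
    (ae_of_all _ fun x => by simpa using laguerreEntropyBound_nonneg lam (x / M))]
  refine lintegral_mono fun x => ?_
  change ∫⁻ y : ℕ, ENNReal.ofReal (-Real.log (laguerrePMF lam (x / M : ℝ≥0) y))
    ∂(laguerreMeasure lam (x / M)) ≤ _
  rw [lintegral_laguerreMeasure]
  simp_rw [← ENNReal.ofReal_mul (laguerrePMF_pos lam (x / M) hlam _).le]
  simpa [laguerreEntropyBound] using tsum_entropy_laguerrePMF_le lam (x / M) hlam

/-- Lower bound on the mutual information for an input of mean `P`. The function `φ` plays the role
of the logarithm of the ratio of the exponential density of mean `P` to the density of `Q`; `hdens`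
asks that `exp φ • Q` be dominated by the exponential law, which leaves room for a `Q` that is not
supported on all of `[0, ∞)`. -/
theorem ofReal_le_mutualInformation {M : ℕ} (hM : 1 ≤ M) {lam : ℝ≥0} (hlam : 0 < lam) {P : ℝ}
    (hP : 0 < P) {Q : Measure ℝ≥0} [IsProbabilityMeasure Q]
    (hint : Integrable (fun x : ℝ≥0 => (x : ℝ)) Q) (hmean : inputMean Q = P)
    {φ : ℝ≥0 → ℝ} (hφm : Measurable φ) (hφ : Integrable φ Q)
    (hdens : ∀ F : ℝ≥0 → ℝ≥0∞, Measurable F → ∫⁻ x, ENNReal.ofReal (Real.exp (φ x)) * F x ∂Q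
      ≤ ∫⁻ x in Ioi (0 : ℝ), ENNReal.ofReal (P⁻¹ * Real.exp (-(x / P))) * F x.toNNReal)
    (hent : Integrable (fun x : ℝ≥0 => laguerreEntropyBound lam (x / M)) Q) :
    ENNReal.ofReal (∫ x, φ x ∂Q + Real.log (1 + (P / M + lam))
        + (P / M + lam) * Real.log (1 + 1 / (P / M + lam))
        - ∫ x : ℝ≥0, laguerreEntropyBound lam (x / M) ∂Q)
      ≤ mutualInformation Q (cdmaKernel M lam) := by
  have hl : (0 : ℝ) < lam := hlam
  have hM0 : (0 : ℝ) < M := by exact_mod_cast hM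
  set N : ℝ := P / M + lam with hN
  have hN0 : 0 < N := by positivity
  set J := Q ⊗ₘ cdmaKernel M lam with hJ
  set W : ℝ≥0 × ℕ → ℝ := fun z => laguerrePMF lam (z.1 / M : ℝ≥0) z.2 with hW
  have hW0 : ∀ z, 0 < W z := fun z => laguerrePMF_pos lam _ hlam _
  have hWm : Measurable W := measurable_from_prod_countable_left fun y =>
    (measurable_laguerrePMF lam y).comp (by fun_prop)
  have hlogW : Measurable fun z => Real.log (W z) := Real.measurable_log.comp hWm
  have hlogW_nonpos : ∀ z, Real.log (W z) ≤ 0 := fun z => by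
    refine Real.log_nonpos (hW0 z).le ?_
    exact le_hasSum (hasSum_laguerrePMF lam (z.1 / M) hlam) z.2
      fun y _ => (laguerrePMF_pos lam _ hlam y).le
  -- the three parts of the test function are integrable under the joint law
  have hmapfst : J.map Prod.fst = Q := Measure.fst_compProd Q (cdmaKernel M lam)
  have hφJ : Integrable (fun z : ℝ≥0 × ℕ => φ z.1) J := by
    have h := hφ
    rw [← hmapfst] at h
    exact h.comp_measurable measurable_fst
  have hφval : ∫ z, φ z.1 ∂J = ∫ x, φ x ∂Q := by
    rw [← integral_map (φ := Prod.fst) (by fun_prop) hφm.aestronglyMeasurable, hmapfst]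
  have hylin := lintegral_compProd_cast (M := M) hlam hint
  rw [hmean] at hylin
  have hyJ : Integrable (fun z : ℝ≥0 × ℕ => (z.2 : ℝ)) J := by
    refine (lintegral_ofReal_ne_top_iff_integrable (Measurable.aestronglyMeasurable (by fun_prop))
      (ae_of_all _ fun z => Nat.cast_nonneg _)).1 ?_
    rw [hylin]
    exact ENNReal.ofReal_ne_top
  have hyval : ∫ z : ℝ≥0 × ℕ, (z.2 : ℝ) ∂J = N := by
    rw [integral_eq_lintegral_of_nonneg_ae (ae_of_all _ fun z => Nat.cast_nonneg _)
      (Measurable.aestronglyMeasurable (by fun_prop)), hylin, ENNReal.toReal_ofReal hN0.le]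
  have hWlin := lintegral_compProd_neg_log_le hlam hent hlogW
  have hWJ : Integrable (fun z => -Real.log (W z)) J := by
    refine (lintegral_ofReal_ne_top_iff_integrable hlogW.neg.aestronglyMeasurable
      (ae_of_all _ fun z => neg_nonneg.2 (hlogW_nonpos z))).1 ?_
    exact ne_top_of_le_ne_top ENNReal.ofReal_ne_top hWlin
  have hWval : ∫ z, -Real.log (W z) ∂J ≤ ∫ x : ℝ≥0, laguerreEntropyBound lam (x / M) ∂Q := by
    rw [integral_eq_lintegral_of_nonneg_ae (ae_of_all _ fun z => neg_nonneg.2 (hlogW_nonpos z))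
      hlogW.neg.aestronglyMeasurable]
    exact ENNReal.toReal_le_of_le_ofReal (integral_nonneg fun x => by
      simpa using laguerreEntropyBound_nonneg lam (x / M)) hWlin
  -- the logarithm of the posterior density of the reference model relative to the input density
  set f : ℝ≥0 × ℕ → ℝ := fun z => φ z.1 +
    (Real.log (1 + N) + z.2 * Real.log (1 + 1 / N)) - -Real.log (W z) with hf
  have hlogN : Real.log (1 + 1 / N) = Real.log (1 + N) - Real.log N := by
    rw [← Real.log_div (by positivity) (by positivity)]
    congr 1
    field_simp
    ring
  have hfm : Measurable f := by
    simp only [hf]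
    fun_prop
  have hgi : Integrable (fun z : ℝ≥0 × ℕ => Real.log (1 + N) + z.2 * Real.log (1 + 1 / N)) J :=
    (integrable_const _).add (hyJ.mul_const _)
  have hφg : Integrable (fun z : ℝ≥0 × ℕ =>
      φ z.1 + (Real.log (1 + N) + z.2 * Real.log (1 + 1 / N))) J := hφJ.add hgi
  have hfi : Integrable f J := hφg.sub hWJ
  have hfval : ∫ z, f z ∂J = ∫ x, φ x ∂Q + (Real.log (1 + N) + N * Real.log (1 + 1 / N))
      - ∫ z, -Real.log (W z) ∂J := by
    simp only [hf]
    rw [integral_sub hφg hWJ, integral_add hφJ hgi,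
      integral_add (integrable_const _) (hyJ.mul_const _), integral_mul_const, hyval, hφval]
    simp
  have hfexp : ∀ z, ENNReal.ofReal (Real.exp (f z)) = ENNReal.ofReal (Real.exp (φ z.1)) *
      (ENNReal.ofReal (W z) * ENNReal.ofReal ((1 + N) ^ (z.2 + 1) / N ^ z.2)) := by
    intro z
    rw [← ENNReal.ofReal_mul (hW0 z).le, ← ENNReal.ofReal_mul (Real.exp_pos _).le]
    congr 1
    have h1 : (1 + N) ^ (z.2 + 1) / N ^ z.2
        = Real.exp (Real.log (1 + N) + z.2 * Real.log (1 + 1 / N)) := by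
      rw [hlogN, Real.exp_add, Real.exp_log (by positivity), ← Real.log_div (by positivity)
        (by positivity), Real.exp_nat_mul, Real.exp_log (by positivity), div_pow, pow_succ]
      ring
    rw [h1]
    rw [← Real.exp_log (hW0 z), ← Real.exp_add, ← Real.exp_add]
    congr 1
    simp only [hf]
    ring
  have hexp : ∫⁻ z, ENNReal.ofReal (Real.exp (f z)) ∂(Q.prod (cdmaKernel M lam ∘ₘ Q)) ≤ 1 := by
    rw [lintegral_prod_symm' _ (by fun_prop)]
    calc ∫⁻ y, ∫⁻ x, ENNReal.ofReal (Real.exp (f (x, y))) ∂Q ∂(cdmaKernel M lam ∘ₘ Q)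
        ≤ ∫⁻ _, 1 ∂(cdmaKernel M lam ∘ₘ Q) := by
          refine lintegral_mono fun y => ?_
          simp only [hfexp]
          have hFm : Measurable fun x : ℝ≥0 => ENNReal.ofReal (W (x, y)) *
              ENNReal.ofReal ((1 + N) ^ (y + 1) / N ^ y) :=
            (ENNReal.measurable_ofReal.comp (hWm.comp measurable_prodMk_right)).mul_const _
          refine (hdens _ hFm).trans ?_
          simp only [← mul_assoc]
          rw [lintegral_mul_const' _ _ ENNReal.ofReal_ne_top]
          simp only [hW]
          rw [lintegral_exp_laguerrePMF hM hlam hP y, ← ENNReal.ofReal_mul (by positivity)]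
          rw [ENNReal.ofReal_le_one]
          refine le_of_eq ?_
          change N ^ y / (1 + N) ^ (y + 1) * ((1 + N) ^ (y + 1) / N ^ y) = 1
          have : 1 + N ≠ 0 := by positivity
          field_simp
      _ = 1 := by simp
  refine le_trans (ENNReal.ofReal_le_ofReal ?_) (ofReal_integral_le_klDiv hfm hfi hexp)
  rw [hfval]
  linarith

/-! ### The tilted family on the unit interval -/

/-- The normalizing constant `∫₀¹ t^(-1/2) exp (-m t) dt`, written in the variable `u = √t`. -/
noncomputable def tiltMass (m : ℝ) : ℝ := ∫ u in (0 : ℝ)..1, 2 * Real.exp (-m * u ^ 2)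

/-- The unnormalized first moment `∫₀¹ t^(1/2) exp (-m t) dt`, written in the variable `u = √t`. -/
noncomputable def tiltMoment (m : ℝ) : ℝ :=
  ∫ u in (0 : ℝ)..1, 2 * (u ^ 2 * Real.exp (-m * u ^ 2))

/-- The mean of the probability density on `[0, 1]` proportional to `t^(-1/2) exp (-m t)`. -/
noncomputable def tiltMean (m : ℝ) : ℝ := tiltMoment m / tiltMass m

theorem tiltMass_pos (m : ℝ) : 0 < tiltMass m :=
  intervalIntegral.intervalIntegral_pos_of_pos (Continuous.intervalIntegrable (by fun_prop) _ _)
    (fun u => by positivity) one_pos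

theorem tiltMoment_pos (m : ℝ) : 0 < tiltMoment m :=
  intervalIntegral.intervalIntegral_pos_of_pos_on
    (Continuous.intervalIntegrable (by fun_prop) _ _)
    (fun u hu => by have := hu.1; positivity) one_pos

theorem tiltMean_pos (m : ℝ) : 0 < tiltMean m := div_pos (tiltMoment_pos m) (tiltMass_pos m)

theorem tiltMoment_eq (m : ℝ) : tiltMoment m = tiltMean m * tiltMass m :=
  (div_mul_cancel₀ _ (tiltMass_pos m).ne').symm

theorem continuous_tiltMass : Continuous tiltMass :=
  intervalIntegral.continuous_parametric_intervalIntegral_of_continuous (by fun_prop)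
    continuous_const

theorem continuous_tiltMoment : Continuous tiltMoment :=
  intervalIntegral.continuous_parametric_intervalIntegral_of_continuous (by fun_prop)
    continuous_const

theorem continuous_tiltMean : Continuous tiltMean :=
  continuous_tiltMoment.div continuous_tiltMass fun m => (tiltMass_pos m).ne'

theorem image_sq_Ioc : (fun u : ℝ => u ^ 2) '' Ioc 0 1 = Ioc 0 1 := by
  ext t
  constructor
  · rintro ⟨u, ⟨h0, h1⟩, rfl⟩
    exact ⟨by positivity, by nlinarith⟩
  · rintro ⟨h0, h1⟩
    exact ⟨√t, ⟨Real.sqrt_pos.2 h0, Real.sqrt_le_one.2 h1⟩, Real.sq_sqrt h0.le⟩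

theorem injOn_sq_Ioc : InjOn (fun u : ℝ => u ^ 2) (Ioc 0 1) := fun _ ha _ hb h =>
  (pow_left_inj₀ ha.1.le hb.1.le two_ne_zero).1 h

theorem hasDerivWithinAt_sq (u : ℝ) (s : Set ℝ) :
    HasDerivWithinAt (fun u : ℝ => u ^ 2) (2 * u) s u := by
  simpa using (hasDerivAt_pow 2 u).hasDerivWithinAt

theorem intervalIntegral_comp_sq (g : ℝ → ℝ) :
    ∫ t in (0 : ℝ)..1, g t = ∫ u in (0 : ℝ)..1, 2 * u * g (u ^ 2) := by
  rw [intervalIntegral.integral_of_le zero_le_one, intervalIntegral.integral_of_le zero_le_one]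
  nth_rewrite 1 [← image_sq_Ioc]
  rw [integral_image_eq_integral_abs_deriv_smul measurableSet_Ioc
    (fun u _ => hasDerivWithinAt_sq u _) injOn_sq_Ioc]
  refine setIntegral_congr_fun measurableSet_Ioc fun u hu => ?_
  have := hu.1
  simp only [smul_eq_mul]
  rw [abs_of_pos (by positivity)]

theorem integral_exp_div_sqrt (m : ℝ) :
    ∫ t in (0 : ℝ)..1, Real.exp (-m * t) / √t = tiltMass m := by
  rw [intervalIntegral_comp_sq, tiltMass, intervalIntegral.integral_of_le zero_le_one,
    intervalIntegral.integral_of_le zero_le_one]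
  refine setIntegral_congr_fun measurableSet_Ioc fun u hu => ?_
  have := hu.1
  simp only [Real.sqrt_sq this.le]
  field_simp

theorem integral_sqrt_mul_exp (m : ℝ) :
    ∫ t in (0 : ℝ)..1, √t * Real.exp (-m * t) = tiltMoment m := by
  rw [intervalIntegral_comp_sq, tiltMoment, intervalIntegral.integral_of_le zero_le_one,
    intervalIntegral.integral_of_le zero_le_one]
  refine setIntegral_congr_fun measurableSet_Ioc fun u hu => ?_
  simp only [Real.sqrt_sq hu.1.le]
  ring

/-- In `IsTilt` the integrals run over `t`; here they are expressed in `u = √t`. -/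
theorem isTilt_iff (α m : ℝ) : IsTilt α m ↔ 0 ≤ m ∧ tiltMean m = α := by
  unfold IsTilt tiltMean
  rw [integral_exp_div_sqrt, integral_sqrt_mul_exp, div_eq_iff (tiltMass_pos m).ne']

/-- Integration by parts. -/
theorem tiltMass_sub (m : ℝ) : tiltMass m - 2 * m * tiltMoment m = 2 * Real.exp (-m) := by
  have h : ∀ u ∈ uIcc (0 : ℝ) 1, HasDerivAt (fun u : ℝ => 2 * (u * Real.exp (-m * u ^ 2)))
      (2 * Real.exp (-m * u ^ 2) - 2 * m * (2 * (u ^ 2 * Real.exp (-m * u ^ 2)))) u := by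
    intro u _
    have h1 : HasDerivAt (fun u : ℝ => -m * u ^ 2) (-m * (2 * u)) u := by
      simpa using (hasDerivAt_pow 2 u).const_mul (-m)
    convert! ((hasDerivAt_id u).mul h1.exp).const_mul 2 using 1
    simp
    ring
  have hftc := intervalIntegral.integral_eq_sub_of_hasDerivAt h
    (Continuous.intervalIntegrable (by fun_prop) _ _)
  rw [intervalIntegral.integral_sub (Continuous.intervalIntegrable (by fun_prop) _ _)
    (Continuous.intervalIntegrable (by fun_prop) _ _), intervalIntegral.integral_const_mul (2 * m)]
    at hftc
  rw [tiltMass, tiltMoment, hftc]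
  simp

/-- This identity turns the factor `1 / 2 - α * μ` of `lowerBound` into the normalizing constant. -/
theorem half_sub_mul_tiltMass (m : ℝ) :
    (1 / 2 - tiltMean m * m) * tiltMass m = Real.exp (-m) := by
  have h := tiltMass_sub m
  rw [tiltMoment_eq] at h
  linarith

theorem tiltMean_zero : tiltMean 0 = 1 / 3 := by
  unfold tiltMean tiltMass tiltMoment
  simp
  norm_num

theorem tiltMean_lt {m : ℝ} (hm : 0 < m) : tiltMean m < 1 / (2 * m) := by
  have h := half_sub_mul_tiltMass m
  have h1 : 0 < 1 / 2 - tiltMean m * m :=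
    pos_of_mul_pos_left (h ▸ Real.exp_pos _) (tiltMass_pos m).le
  rw [lt_div_iff₀ (by positivity)]
  linarith

/-- The mean is strictly decreasing in the parameter: the deviation from the mean and the
exponential tilt are oppositely ordered. -/
theorem tiltMean_strictAnti : StrictAnti tiltMean := by
  intro m₁ m₂ hm
  set a := tiltMean m₁ with ha
  have ha0 : 0 < a := tiltMean_pos m₁
  set δ := m₂ - m₁ with hδ
  have hδ0 : 0 < δ := sub_pos.2 hm
  -- both differences have the sign of `a - u ^ 2`
  have hpos : 0 < ∫ u in (0 : ℝ)..1, (a - u ^ 2) *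
      (Real.exp (-δ * u ^ 2) - Real.exp (-δ * a)) * (2 * Real.exp (-m₁ * u ^ 2)) := by
    refine intervalIntegral.integral_pos one_pos (by fun_prop) (fun u _ => ?_)
      ⟨0, by simp, ?_⟩
    · refine mul_nonneg ?_ (by positivity)
      rcases le_total (u ^ 2) a with h | h
      · refine mul_nonneg (by linarith) (sub_nonneg.2 (Real.exp_le_exp.2 ?_))
        nlinarith
      · refine mul_nonneg_of_nonpos_of_nonpos (by linarith) (sub_nonpos.2 (Real.exp_le_exp.2 ?_))
        nlinarith
    · have : Real.exp (-δ * a) < 1 := Real.exp_lt_one_iff.2 (by nlinarith)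
      have h2 := mul_pos ha0 (sub_pos.2 this)
      simpa using h2
  have hval : ∫ u in (0 : ℝ)..1, (a - u ^ 2) *
      (Real.exp (-δ * u ^ 2) - Real.exp (-δ * a)) * (2 * Real.exp (-m₁ * u ^ 2))
      = a * tiltMass m₂ - tiltMoment m₂
        - Real.exp (-δ * a) * (a * tiltMass m₁ - tiltMoment m₁) := by
    simp only [tiltMass, tiltMoment, ← intervalIntegral.integral_const_mul]
    rw [← intervalIntegral.integral_sub, ← intervalIntegral.integral_sub,
      ← intervalIntegral.integral_const_mul, ← intervalIntegral.integral_sub]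
    · refine intervalIntegral.integral_congr fun u _ => ?_
      have : Real.exp (-m₂ * u ^ 2) = Real.exp (-δ * u ^ 2) * Real.exp (-m₁ * u ^ 2) := by
        rw [← Real.exp_add, hδ]
        ring_nf
      simp only [this]
      ring
    all_goals exact Continuous.intervalIntegrable (by fun_prop) _ _
  rw [hval, tiltMoment_eq m₁, ← ha, sub_self, mul_zero, sub_zero, tiltMoment_eq m₂] at hpos
  have := tiltMass_pos m₂
  nlinarith

theorem existsUnique_isTilt {α : ℝ} (h0 : 0 < α) (h1 : α ≤ 1 / 3) : ∃! m : ℝ, IsTilt α m := by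
  have hm : 0 < 1 / (2 * α) := by positivity
  have hle : tiltMean (1 / (2 * α)) ≤ α := by
    refine (tiltMean_lt hm).le.trans_eq ?_
    field_simp
  obtain ⟨m, hm1, hm2⟩ := intermediate_value_Icc' hm.le continuous_tiltMean.continuousOn
    ⟨hle, h1.trans_eq tiltMean_zero.symm⟩
  refine ⟨m, (isTilt_iff α m).2 ⟨hm1.1, hm2⟩, fun m' hm' => ?_⟩
  exact tiltMean_strictAnti.injective ((((isTilt_iff α m').1 hm').2).trans hm2.symm)

theorem tilt_tiltMean {m : ℝ} (hm : 0 ≤ m) : tilt (tiltMean m) = m := by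
  have h : IsTilt (tiltMean m) m := (isTilt_iff _ _).2 ⟨hm, rfl⟩
  exact tiltMean_strictAnti.injective ((isTilt_iff _ _).1 (Classical.epsilon_spec ⟨m, h⟩)).2

theorem exists_tiltMean_eq {α : ℝ} (h0 : 0 < α) (h1 : α ≤ 1 / 3) :
    ∃ m, 0 ≤ m ∧ tiltMean m = α := by
  obtain ⟨m, hm, -⟩ := existsUnique_isTilt h0 h1
  exact ⟨m, (isTilt_iff α m).1 hm⟩

/-- Gibbs' inequality for the tilted family: the left side is the entropy of the member `m₂`
relative to the weight `t^(-1/2)`, the right side its cross entropy with the member `m₁`. -/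
theorem log_tiltMass_add_le (m₁ m₂ : ℝ) :
    Real.log (tiltMass m₂) + m₂ * tiltMean m₂ ≤ Real.log (tiltMass m₁) + m₁ * tiltMean m₂ := by
  set a := tiltMean m₂ with ha
  -- Jensen for the exponential under the member `m₂`
  have key : Real.exp ((m₂ - m₁) * a) * tiltMass m₂ ≤ tiltMass m₁ := by
    have hval : ∫ u in (0 : ℝ)..1, Real.exp ((m₂ - m₁) * a) *
        ((1 + ((m₂ - m₁) * u ^ 2 - (m₂ - m₁) * a)) * (2 * Real.exp (-m₂ * u ^ 2)))
        = Real.exp ((m₂ - m₁) * a) * tiltMass m₂ := by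
      have h2 : tiltMass m₂ = (1 - (m₂ - m₁) * a) * tiltMass m₂ + (m₂ - m₁) * tiltMoment m₂ := by
        rw [tiltMoment_eq, ← ha]
        ring
      rw [intervalIntegral.integral_const_mul]
      congr 1
      rw [h2]
      simp only [tiltMass, tiltMoment, ← intervalIntegral.integral_const_mul]
      rw [← intervalIntegral.integral_add]
      · refine intervalIntegral.integral_congr fun u _ => ?_
        ring
      all_goals exact Continuous.intervalIntegrable (by fun_prop) _ _
    rw [← hval, tiltMass]
    refine intervalIntegral.integral_mono_on zero_le_one
      (Continuous.intervalIntegrable (by fun_prop) _ _)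
      (Continuous.intervalIntegrable (by fun_prop) _ _) fun u _ => ?_
    have h := Real.add_one_le_exp ((m₂ - m₁) * u ^ 2 - (m₂ - m₁) * a)
    calc Real.exp ((m₂ - m₁) * a) *
        ((1 + ((m₂ - m₁) * u ^ 2 - (m₂ - m₁) * a)) * (2 * Real.exp (-m₂ * u ^ 2)))
        ≤ Real.exp ((m₂ - m₁) * a) * (Real.exp ((m₂ - m₁) * u ^ 2 - (m₂ - m₁) * a)
          * (2 * Real.exp (-m₂ * u ^ 2))) := by
          gcongr
          linarith
      _ = 2 * Real.exp (-m₁ * u ^ 2) := by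
          rw [mul_left_comm (Real.exp _) 2, mul_left_comm (Real.exp _) 2, ← Real.exp_add,
            ← Real.exp_add]
          ring_nf
  have h := Real.log_le_log (mul_pos (Real.exp_pos _) (tiltMass_pos m₂)) key
  rw [Real.log_mul (Real.exp_pos _).ne' (tiltMass_pos m₂).ne', Real.log_exp] at h
  linarith

theorem tiltMass_antitone : Antitone tiltMass := by
  intro m₁ m₂ hm
  refine intervalIntegral.integral_mono_on zero_le_one
    (Continuous.intervalIntegrable (by fun_prop) _ _)
    (Continuous.intervalIntegrable (by fun_prop) _ _) fun u _ => ?_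
  gcongr

theorem tiltMass_le_two {m : ℝ} (hm : 0 ≤ m) : tiltMass m ≤ 2 := by
  refine (tiltMass_antitone hm).trans_eq ?_
  simp [tiltMass]

theorem tiltMass_le_sqrt {m : ℝ} (hm : 0 < m) : tiltMass m ≤ 2 * √(Real.pi / m) := by
  rw [tiltMass, intervalIntegral.integral_const_mul, ← integral_gaussian,
    intervalIntegral.integral_of_le zero_le_one]
  refine mul_le_mul_of_nonneg_left ?_ zero_le_two
  exact setIntegral_le_integral (integrable_exp_neg_mul_sq hm)
    (ae_of_all _ fun t => (Real.exp_pos _).le)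

/-- A polynomial lower bound for the moment, from the contribution of `u ≤ 1 / √m` alone. -/
theorem le_tiltMoment {m : ℝ} (hm : 1 ≤ m) :
    2 / 3 * Real.exp (-1) * (√m)⁻¹ ^ 3 ≤ tiltMoment m := by
  have hs1 : 1 ≤ √m := Real.one_le_sqrt.2 hm
  have hs0 : 0 < (√m)⁻¹ := by positivity
  have hs : (√m)⁻¹ ≤ 1 := inv_le_one_of_one_le₀ hs1
  have h1 : ∫ u in (0 : ℝ)..(√m)⁻¹, 2 * (u ^ 2 * Real.exp (-1))
      = 2 / 3 * Real.exp (-1) * (√m)⁻¹ ^ 3 := by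
    rw [intervalIntegral.integral_const_mul, intervalIntegral.integral_mul_const, integral_pow]
    norm_num
    ring
  rw [← h1]
  calc ∫ u in (0 : ℝ)..(√m)⁻¹, 2 * (u ^ 2 * Real.exp (-1))
      ≤ ∫ u in (0 : ℝ)..(√m)⁻¹, 2 * (u ^ 2 * Real.exp (-m * u ^ 2)) := by
        refine intervalIntegral.integral_mono_on hs0.le
          (Continuous.intervalIntegrable (by fun_prop) _ _)
          (Continuous.intervalIntegrable (by fun_prop) _ _) fun u hu => ?_
        have hu2 : m * u ^ 2 ≤ 1 := by
          have h3 : u ^ 2 ≤ (√m)⁻¹ ^ 2 := pow_le_pow_left₀ hu.1 hu.2 2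
          rw [inv_pow, Real.sq_sqrt (by linarith)] at h3
          calc m * u ^ 2 ≤ m * m⁻¹ := by gcongr
            _ = 1 := mul_inv_cancel₀ (by linarith)
        gcongr
        linarith
    _ ≤ tiltMoment m := by
        refine intervalIntegral.integral_mono_interval le_rfl hs0.le hs
          (ae_of_all _ fun u => ?_) (Continuous.intervalIntegrable (by fun_prop) _ _)
        simp only [Pi.zero_apply]
        positivity

/-! ### The input law and its mutual information -/

/-- The density of `u = √(x / A)` on `(0, 1)` when `x / A` has density proportional to
`t^(-1/2) exp (-m t)`. -/
noncomputable def tiltDensity (m u : ℝ) : ℝ := 2 * Real.exp (-m * u ^ 2) / tiltMass m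

theorem tiltDensity_nonneg (m u : ℝ) : 0 ≤ tiltDensity m u :=
  div_nonneg (by positivity) (tiltMass_pos m).le

theorem continuous_tiltDensity (m : ℝ) : Continuous (tiltDensity m) := by
  unfold tiltDensity
  fun_prop

/-- The input law, with density proportional to `x^(-1/2) exp (-m x / A)` on `(0, A)`. It is encoded
as the image of the law of `u` under `u ↦ A u ^ 2`. -/
noncomputable def tiltLaw (A m : ℝ) : Measure ℝ≥0 :=
  ((volume.restrict (Ioo (0 : ℝ) 1)).withDensity fun u => ENNReal.ofReal (tiltDensity m u)).map
    fun u => (A * u ^ 2).toNNReal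

theorem lintegral_tiltLaw (A m : ℝ) {F : ℝ≥0 → ℝ≥0∞} (hF : Measurable F) :
    ∫⁻ x, F x ∂(tiltLaw A m)
      = ∫⁻ u in Ioo (0 : ℝ) 1, ENNReal.ofReal (tiltDensity m u) * F (A * u ^ 2).toNNReal := by
  have hm := (continuous_tiltDensity m).measurable
  unfold tiltLaw
  rw [lintegral_map hF (by fun_prop), lintegral_withDensity_eq_lintegral_mul _ (by fun_prop)
    (by fun_prop)]
  rfl

theorem integrable_tiltLaw_iff (A m : ℝ) {g : ℝ≥0 → ℝ} (hg : Measurable g) :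
    Integrable g (tiltLaw A m) ↔
      IntegrableOn (fun u => tiltDensity m u * g (A * u ^ 2).toNNReal) (Ioo 0 1) := by
  have hm := (continuous_tiltDensity m).measurable
  unfold tiltLaw
  rw [integrable_map_measure hg.aestronglyMeasurable (by fun_prop),
    integrable_withDensity_iff_integrable_smul' (by fun_prop)
      (ae_of_all _ fun u => ENNReal.ofReal_lt_top)]
  simp only [ENNReal.toReal_ofReal (tiltDensity_nonneg m _), smul_eq_mul, IntegrableOn,
    Function.comp_apply]

theorem integral_tiltLaw (A m : ℝ) {g : ℝ≥0 → ℝ} (hg : Measurable g) :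
    ∫ x, g x ∂(tiltLaw A m)
      = ∫ u in Ioo (0 : ℝ) 1, tiltDensity m u * g (A * u ^ 2).toNNReal := by
  have hm := (continuous_tiltDensity m).measurable
  unfold tiltLaw
  rw [integral_map (by fun_prop) hg.aestronglyMeasurable,
    integral_withDensity_eq_integral_toReal_smul (by fun_prop)
      (ae_of_all _ fun u => ENNReal.ofReal_lt_top)]
  simp only [ENNReal.toReal_ofReal (tiltDensity_nonneg m _), smul_eq_mul]

theorem setIntegral_tiltDensity (m : ℝ) : ∫ u in Ioo (0 : ℝ) 1, tiltDensity m u = 1 := by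
  rw [← integral_Ioc_eq_integral_Ioo, ← intervalIntegral.integral_of_le zero_le_one]
  simp only [tiltDensity]
  rw [intervalIntegral.integral_div]
  exact div_self (tiltMass_pos m).ne'

theorem setIntegral_tiltDensity_mul_sq (m : ℝ) :
    ∫ u in Ioo (0 : ℝ) 1, tiltDensity m u * u ^ 2 = tiltMean m := by
  rw [← integral_Ioc_eq_integral_Ioo, ← intervalIntegral.integral_of_le zero_le_one, tiltMean,
    tiltMoment, ← intervalIntegral.integral_div]
  refine intervalIntegral.integral_congr fun u _ => ?_
  simp only [tiltDensity]
  ring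

theorem integrableOn_tiltDensity_mul {m : ℝ} {g : ℝ → ℝ} (hg : IntervalIntegrable g volume 0 1) :
    IntegrableOn (fun u => tiltDensity m u * g u) (Ioo 0 1) := by
  have h := hg.continuousOn_mul (continuous_tiltDensity m).continuousOn
  exact ((intervalIntegrable_iff_integrableOn_Ioc_of_le zero_le_one).1 h).mono_set
    Ioo_subset_Ioc_self

instance isProbabilityMeasure_tiltLaw (A m : ℝ) : IsProbabilityMeasure (tiltLaw A m) := by
  constructor
  rw [← lintegral_one, lintegral_tiltLaw A m measurable_const]
  simp only [mul_one]
  have hi : IntegrableOn (tiltDensity m) (Ioo 0 1) := by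
    simpa using integrableOn_tiltDensity_mul (m := m) (g := fun _ => 1) (by simp)
  rw [← ofReal_integral_eq_lintegral_ofReal hi (ae_of_all _ fun u => tiltDensity_nonneg m u),
    setIntegral_tiltDensity, ENNReal.ofReal_one]

theorem integrable_coe_tiltLaw {A : ℝ} (hA : 0 < A) (m : ℝ) :
    Integrable (fun x : ℝ≥0 => (x : ℝ)) (tiltLaw A m) := by
  rw [integrable_tiltLaw_iff A m (by fun_prop)]
  simp_rw [fun u : ℝ => Real.coe_toNNReal (A * u ^ 2) (by positivity)]
  exact integrableOn_tiltDensity_mul (Continuous.intervalIntegrable (by fun_prop) _ _)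

theorem inputMean_tiltLaw {A : ℝ} (hA : 0 < A) (m : ℝ) :
    inputMean (tiltLaw A m) = tiltMean m * A := by
  unfold inputMean
  rw [integral_tiltLaw A m (by fun_prop)]
  simp_rw [fun u : ℝ => Real.coe_toNNReal (A * u ^ 2) (by positivity), mul_left_comm _ A]
  rw [integral_const_mul, setIntegral_tiltDensity_mul_sq, mul_comm]

theorem isAdmissible_tiltLaw {A E m : ℝ} (hA : 0 < A) (hE : tiltMean m * A ≤ E) :
    IsAdmissible A E (tiltLaw A m) where
  isProbabilityMeasure := inferInstance
  peak := by
    have hs : MeasurableSet {x : ℝ≥0 | A ≤ (x : ℝ)} := measurableSet_le (by fun_prop) (by fun_prop)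
    rw [← lintegral_indicator_one hs, lintegral_tiltLaw A m (measurable_one.indicator hs)]
    rw [setLIntegral_congr_fun (g := 0) measurableSet_Ioo fun u hu => ?_]
    · simp
    · have h1 : A * u ^ 2 < A := by
        have : u ^ 2 < 1 := by nlinarith [hu.1, hu.2]
        nlinarith
      have h2 : (A * u ^ 2).toNNReal ∉ {x : ℝ≥0 | A ≤ (x : ℝ)} := by
        simp only [mem_ofPred_eq, not_le]
        rwa [Real.coe_toNNReal _ (by positivity)]
      simp [h2]
  average := (inputMean_tiltLaw hA m).trans_le hE

theorem intervalIntegrable_log_sq_add {κ : ℝ} (hκ : 0 < κ) :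
    IntervalIntegrable (fun u : ℝ => Real.log (u ^ 2 + κ)) volume 0 1 :=
  Continuous.intervalIntegrable (Continuous.log (by fun_prop) fun u => by positivity) _ _

/-- The closed form of `∫₀¹ log (1 + κ / u ^ 2) du`, with the logarithm of the quotient split. -/
theorem integral_log_sq_add_sub {κ : ℝ} (hκ : 0 < κ) :
    ∫ u in (0 : ℝ)..1, (Real.log (u ^ 2 + κ) - 2 * Real.log u)
      = 2 * √κ * Real.arctan √κ⁻¹ + Real.log (1 + κ) := by
  have hs : 0 < √κ := Real.sqrt_pos.2 hκ
  have hlog : Continuous fun u : ℝ => Real.log (u ^ 2 + κ) :=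
    Continuous.log (by fun_prop) fun u => by positivity
  have h := intervalIntegral.integral_eq_sub_of_hasDerivAt_of_le (zero_le_one (α := ℝ))
    (f := fun u : ℝ => u * Real.log (u ^ 2 + κ) - 2 * (u * Real.log u)
      + 2 * √κ * Real.arctan (u / √κ))
    (f' := fun u => Real.log (u ^ 2 + κ) - 2 * Real.log u) (Continuous.continuousOn ?_)
    (fun u hu => ?_)
    ((intervalIntegrable_log_sq_add hκ).sub (intervalIntegral.intervalIntegrable_log'.const_mul 2))
  · rw [h, Real.sqrt_inv]
    simp
    ring
  · exact ((continuous_id.mul hlog).sub (continuous_const.mul Real.continuous_mul_log)).add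
      (continuous_const.mul (Real.continuous_arctan.comp (by fun_prop)))
  · have hu0 : u ≠ 0 := hu.1.ne'
    have h1 : HasDerivAt (fun u : ℝ => u ^ 2 + κ) (2 * u) u := by
      simpa using (hasDerivAt_pow 2 u).add_const κ
    have h2 := (hasDerivAt_id u).mul (h1.log (by positivity))
    have h3 := (Real.hasDerivAt_mul_log hu0).const_mul 2
    have h4 := (((hasDerivAt_id u).div_const √κ).arctan).const_mul (2 * √κ)
    convert! (h2.sub h3).add h4 using 1
    have hsq : √κ ^ 2 = κ := Real.sq_sqrt hκ.le
    simp only [id]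
    rw [div_pow, hsq]
    field_simp
    ring

/-- Logarithm of the ratio of the exponential density of mean `P` to the density of `tiltLaw A
m`. -/
noncomputable def logDensityRatio (A P m : ℝ) (x : ℝ≥0) : ℝ :=
  Real.log (tiltMass m * A / P) + (-(x / P) + m * (x / A) + 1 / 2 * Real.log (x / A))

theorem measurable_logDensityRatio (A P m : ℝ) : Measurable (logDensityRatio A P m) := by
  unfold logDensityRatio
  fun_prop

theorem logDensityRatio_sq {A : ℝ} (hA : 0 < A) (P m u : ℝ) :
    logDensityRatio A P m (A * u ^ 2).toNNReal
      = Real.log (tiltMass m * A / P) + ((m - A / P) * u ^ 2 + Real.log u) := by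
  unfold logDensityRatio
  rw [Real.coe_toNNReal _ (by positivity), mul_div_cancel_left₀ _ hA.ne', Real.log_pow]
  push_cast
  ring

theorem lintegral_exp_logDensityRatio_le {A P : ℝ} (hA : 0 < A) (hP : 0 < P) (m : ℝ)
    {F : ℝ≥0 → ℝ≥0∞} (hF : Measurable F) :
    ∫⁻ x, ENNReal.ofReal (Real.exp (logDensityRatio A P m x)) * F x ∂(tiltLaw A m)
      ≤ ∫⁻ x in Ioi (0 : ℝ), ENNReal.ofReal (P⁻¹ * Real.exp (-(x / P))) * F x.toNNReal := by
  have hm := measurable_logDensityRatio A P m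
  have hZ := tiltMass_pos m
  rw [lintegral_tiltLaw A m (by fun_prop)]
  have hderiv : ∀ u ∈ Ioo (0 : ℝ) 1,
      HasDerivWithinAt (fun u : ℝ => A * u ^ 2) (A * (2 * u)) (Ioo 0 1) u := fun u _ =>
    (hasDerivWithinAt_sq u _).const_mul A
  have hinj : InjOn (fun u : ℝ => A * u ^ 2) (Ioo 0 1) := fun a ha b hb h =>
    injOn_sq_Ioc (Ioo_subset_Ioc_self ha) (Ioo_subset_Ioc_self hb) (mul_left_cancel₀ hA.ne' h)
  calc ∫⁻ u in Ioo (0 : ℝ) 1, ENNReal.ofReal (tiltDensity m u) *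
        (ENNReal.ofReal (Real.exp (logDensityRatio A P m (A * u ^ 2).toNNReal)) *
          F (A * u ^ 2).toNNReal)
      = ∫⁻ u in Ioo (0 : ℝ) 1, ENNReal.ofReal |A * (2 * u)| *
          (ENNReal.ofReal (P⁻¹ * Real.exp (-(A * u ^ 2 / P))) * F (A * u ^ 2).toNNReal) := by
        refine setLIntegral_congr_fun measurableSet_Ioo fun u hu => ?_
        have hu0 : 0 < u := hu.1
        rw [← mul_assoc, ← mul_assoc, ← ENNReal.ofReal_mul (tiltDensity_nonneg m u),
          ← ENNReal.ofReal_mul (abs_nonneg _), abs_of_pos (by positivity)]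
        congr 2
        rw [logDensityRatio_sq hA, tiltDensity, Real.exp_add, Real.exp_log (by positivity),
          Real.exp_add, Real.exp_log hu0, show -(A * u ^ 2 / P)
            = -m * u ^ 2 + (m - A / P) * u ^ 2 by ring, Real.exp_add]
        field_simp
    _ = ∫⁻ x in (fun u : ℝ => A * u ^ 2) '' Ioo 0 1,
          ENNReal.ofReal (P⁻¹ * Real.exp (-(x / P))) * F x.toNNReal :=
        (lintegral_image_eq_lintegral_abs_deriv_mul measurableSet_Ioo hderiv hinj
          fun x => ENNReal.ofReal (P⁻¹ * Real.exp (-(x / P))) * F x.toNNReal).symm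
    _ ≤ ∫⁻ x in Ioi (0 : ℝ), ENNReal.ofReal (P⁻¹ * Real.exp (-(x / P))) * F x.toNNReal := by
        refine lintegral_mono_set ?_
        rintro _ ⟨u, hu, rfl⟩
        have hu0 : 0 < u := hu.1
        exact mul_pos hA (by positivity)

theorem integrable_logDensityRatio {A : ℝ} (hA : 0 < A) (P m : ℝ) :
    Integrable (logDensityRatio A P m) (tiltLaw A m) := by
  rw [integrable_tiltLaw_iff A m (measurable_logDensityRatio A P m)]
  simp_rw [logDensityRatio_sq hA]
  exact integrableOn_tiltDensity_mul (IntervalIntegrable.add (by simp)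
    ((Continuous.intervalIntegrable (by fun_prop) _ _).add
      intervalIntegral.intervalIntegrable_log'))

theorem integral_logDensityRatio {A : ℝ} (hA : 0 < A) (P m : ℝ) :
    ∫ x, logDensityRatio A P m x ∂(tiltLaw A m)
      = Real.log (tiltMass m * A / P) + (m - A / P) * tiltMean m
        + ∫ u in Ioo (0 : ℝ) 1, tiltDensity m u * Real.log u := by
  rw [integral_tiltLaw A m (measurable_logDensityRatio A P m)]
  simp_rw [logDensityRatio_sq hA]
  have h1 := integrableOn_tiltDensity_mul (m := m) (g := fun _ => Real.log (tiltMass m * A / P))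
    (by simp)
  have h2 := integrableOn_tiltDensity_mul (m := m) (g := fun u => (m - A / P) * u ^ 2)
    (Continuous.intervalIntegrable (by fun_prop) _ _)
  have h3 := integrableOn_tiltDensity_mul (m := m) (g := Real.log)
    intervalIntegral.intervalIntegrable_log'
  have h23 : IntegrableOn (fun u => tiltDensity m u * ((m - A / P) * u ^ 2)
    + tiltDensity m u * Real.log u) (Ioo 0 1) := h2.add h3
  simp_rw [mul_add]
  rw [integral_add h1 h23, integral_add h2 h3, integral_mul_const, setIntegral_tiltDensity]
  simp_rw [mul_left_comm _ (m - A / P)]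
  rw [integral_const_mul, setIntegral_tiltDensity_mul_sq]
  ring

theorem noiseRatio_pos {A P β : ℝ} {M : ℕ} (hA : 0 < A) (hP : 0 ≤ P) (hβ : 0 < β) (hM : 1 ≤ M) :
    0 < noiseRatio A P β M := by
  have hM0 : (0 : ℝ) < M := by exact_mod_cast hM
  unfold noiseRatio
  positivity

theorem laguerreEntropyBound_sq {A P β : ℝ} {M : ℕ} (hA : 0 < A) (hP : 0 ≤ P) (hβ : 0 < β)
    (hM : 1 ≤ M) (u : ℝ) :
    laguerreEntropyBound (β * P) (A * u ^ 2 / M)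
      = (1 / 2 * Real.log (2 * Real.pi * Real.exp 1) + 1 / 2 * Real.log ((2 * (β * P) + 1) / M)
        + 1 / 2 * Real.log A) + 1 / 2 * Real.log (u ^ 2 + noiseRatio A P β M) := by
  have hM0 : (0 : ℝ) < M := by exact_mod_cast hM
  have hκ := noiseRatio_pos hA hP hβ hM
  unfold laguerreEntropyBound
  rw [← mul_add, ← mul_add, ← mul_add, ← Real.log_mul (by positivity) (by positivity),
    ← Real.log_mul (by positivity) (by positivity), ← Real.log_mul (by positivity) (by positivity)]
  congr 2
  unfold noiseRatio
  field_simp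
  ring

theorem measurable_laguerreEntropyBound (lam : ℝ) (M : ℕ) :
    Measurable fun x : ℝ≥0 => laguerreEntropyBound lam (x / M) := by
  unfold laguerreEntropyBound
  fun_prop

theorem integrable_laguerreEntropyBound {A P β : ℝ} {M : ℕ} (hA : 0 < A) (hP : 0 ≤ P) (hβ : 0 < β)
    (hM : 1 ≤ M) (m : ℝ) :
    Integrable (fun x : ℝ≥0 => laguerreEntropyBound (β * P) (x / M)) (tiltLaw A m) := by
  rw [integrable_tiltLaw_iff A m (measurable_laguerreEntropyBound _ M)]
  simp_rw [fun u : ℝ => Real.coe_toNNReal (A * u ^ 2) (by positivity),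
    laguerreEntropyBound_sq hA hP hβ hM]
  exact integrableOn_tiltDensity_mul (IntervalIntegrable.add (by simp)
    ((intervalIntegrable_log_sq_add (noiseRatio_pos hA hP hβ hM)).const_mul _))

theorem integral_laguerreEntropyBound {A P β : ℝ} {M : ℕ} (hA : 0 < A) (hP : 0 ≤ P) (hβ : 0 < β)
    (hM : 1 ≤ M) (m : ℝ) :
    ∫ x : ℝ≥0, laguerreEntropyBound (β * P) (x / M) ∂(tiltLaw A m)
      = (1 / 2 * Real.log (2 * Real.pi * Real.exp 1) + 1 / 2 * Real.log ((2 * (β * P) + 1) / M)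
        + 1 / 2 * Real.log A)
        + ∫ u in Ioo (0 : ℝ) 1,
            tiltDensity m u * (1 / 2 * Real.log (u ^ 2 + noiseRatio A P β M)) := by
  rw [integral_tiltLaw A m (measurable_laguerreEntropyBound _ M)]
  simp_rw [fun u : ℝ => Real.coe_toNNReal (A * u ^ 2) (by positivity),
    laguerreEntropyBound_sq hA hP hβ hM]
  set K := 1 / 2 * Real.log (2 * Real.pi * Real.exp 1)
    + 1 / 2 * Real.log ((2 * (β * P) + 1) / M) + 1 / 2 * Real.log A
  simp_rw [mul_add (tiltDensity m _) K]
  rw [integral_add (integrableOn_tiltDensity_mul (by simp)) (integrableOn_tiltDensity_mul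
    ((intervalIntegrable_log_sq_add (noiseRatio_pos hA hP hβ hM)).const_mul _)),
    integral_mul_const, setIntegral_tiltDensity, one_mul]

/-- The loss from bounding the conditional entropy, estimated with `exp (-m u ^ 2) ≤ 1`. -/
theorem setIntegral_tiltDensity_mul_log_sub_le {m κ : ℝ} (hm : 0 ≤ m) (hκ : 0 < κ) :
    (∫ u in Ioo (0 : ℝ) 1, tiltDensity m u * (1 / 2 * Real.log (u ^ 2 + κ)))
        - ∫ u in Ioo (0 : ℝ) 1, tiltDensity m u * Real.log u
      ≤ (2 * √κ * Real.arctan √κ⁻¹ + Real.log (1 + κ)) / tiltMass m := by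
  have hZ := tiltMass_pos m
  have h1 := integrableOn_tiltDensity_mul (m := m)
    ((intervalIntegrable_log_sq_add hκ).const_mul (1 / 2))
  have h2 := integrableOn_tiltDensity_mul (m := m) (g := Real.log)
    intervalIntegral.intervalIntegrable_log'
  have h3 : IntervalIntegrable (fun u : ℝ => Real.log (u ^ 2 + κ) - 2 * Real.log u) volume 0 1 :=
    (intervalIntegrable_log_sq_add hκ).sub (intervalIntegral.intervalIntegrable_log'.const_mul 2)
  rw [← integral_sub h1 h2, ← integral_log_sq_add_sub hκ,
    intervalIntegral.integral_of_le zero_le_one, integral_Ioc_eq_integral_Ioo, ← integral_div]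
  refine setIntegral_mono_on (h1.sub h2) ((((intervalIntegrable_iff_integrableOn_Ioc_of_le
    zero_le_one).1 h3).mono_set Ioo_subset_Ioc_self).div_const _) measurableSet_Ioo fun u hu => ?_
  have hu0 : 0 < u := hu.1
  have hnn : 0 ≤ Real.log (u ^ 2 + κ) - 2 * Real.log u := by
    have : Real.log (u ^ 2) ≤ Real.log (u ^ 2 + κ) :=
      Real.log_le_log (by positivity) (by linarith)
    rw [Real.log_pow] at this
    push_cast at this
    linarith
  have hexp : Real.exp (-m * u ^ 2) ≤ 1 := Real.exp_le_one_iff.2 (by nlinarith [sq_nonneg u])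
  calc tiltDensity m u * (1 / 2 * Real.log (u ^ 2 + κ)) - tiltDensity m u * Real.log u
      = Real.exp (-m * u ^ 2) * (Real.log (u ^ 2 + κ) - 2 * Real.log u) / tiltMass m := by
        unfold tiltDensity
        ring
    _ ≤ 1 * (Real.log (u ^ 2 + κ) - 2 * Real.log u) / tiltMass m := by gcongr
    _ = (Real.log (u ^ 2 + κ) - 2 * Real.log u) / tiltMass m := by rw [one_mul]

/-- The lower bound at the mean of a tilted density: entropy of the input, loss from the conditional
entropy, and terms that depend on the power only. -/
theorem lowerBound_tiltMean (A P β : ℝ) (M : ℕ) {m : ℝ} (hm : 0 ≤ m) :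
    lowerBound A P β M (tiltMean m)
      = 1 / 2 * Real.log A + (Real.log (tiltMass m) + m * tiltMean m)
        - (2 * √(noiseRatio A P β M) * Real.arctan √(noiseRatio A P β M)⁻¹
          + Real.log (1 + noiseRatio A P β M)) / tiltMass m
        + (Real.log (1 / M + (1 + β * P) / P) - 1 / 2 * Real.log (2 * Real.pi * Real.exp 1) - 1
          - 1 / 2 * Real.log ((2 * (β * P) + 1) / M)
          + (P / M + β * P) * Real.log (1 + 1 / (P / M + β * P))) := by
  have hZ := tiltMass_pos m
  have h := half_sub_mul_tiltMass m
  have h1 : 1 / 2 - tiltMean m * m = Real.exp (-m) / tiltMass m := by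
    rw [eq_div_iff hZ.ne', h]
  have h2 : Real.exp m * (Real.exp (-m) / tiltMass m) = 1 / tiltMass m := by
    rw [← mul_div_assoc, ← Real.exp_add, add_neg_cancel, Real.exp_zero]
  unfold lowerBound
  rw [tilt_tiltMean hm, h1, h2, Real.log_div (Real.exp_pos _).ne' hZ.ne', Real.log_exp]
  ring

theorem ofReal_lowerBound_le_capacity {A E β : ℝ} {M : ℕ} (hA : 0 < A) (hβ : 0 < β) (hM : 1 ≤ M)
    {m : ℝ} (hm : 0 ≤ m) (hE : tiltMean m * A ≤ E) :
    ENNReal.ofReal (lowerBound A (tiltMean m * A) β M (tiltMean m)) ≤ capacity A E β M := by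
  have hα := tiltMean_pos m
  have hZ := tiltMass_pos m
  have hM0 : (0 : ℝ) < M := by exact_mod_cast hM
  set P := tiltMean m * A with hPdef
  have hP : 0 < P := mul_pos hα hA
  have hmean : inputMean (tiltLaw A m) = P := inputMean_tiltLaw hA m
  have hlam : ((β * P).toNNReal : ℝ) = β * P := Real.coe_toNNReal _ (by positivity)
  have hI := ofReal_le_mutualInformation hM (lam := (β * P).toNNReal)
    (Real.toNNReal_pos.2 (by positivity)) hP (integrable_coe_tiltLaw hA m) hmean
    (measurable_logDensityRatio A P m) (integrable_logDensityRatio hA P m)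
    (fun F hF => lintegral_exp_logDensityRatio_le hA hP m hF)
    (by rw [hlam]; exact integrable_laguerreEntropyBound hA hP.le hβ hM m)
  have hcap : mutualInformation (tiltLaw A m) (cdmaKernel M (β * P).toNNReal)
      ≤ capacity A E β M := by
    have := le_iSup₂ (f := fun (Q : Measure ℝ≥0) (_ : IsAdmissible A E Q) =>
      mutualInformation Q (cdmaKernel M (β * inputMean Q).toNNReal)) (tiltLaw A m)
      (isAdmissible_tiltLaw hA hE)
    rwa [hmean] at this
  refine le_trans (ENNReal.ofReal_le_ofReal ?_) (hI.trans hcap)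
  have hgap := setIntegral_tiltDensity_mul_log_sub_le hm (noiseRatio_pos hA hP.le hβ hM)
  rw [hlam, integral_laguerreEntropyBound hA hP.le hβ hM, integral_logDensityRatio hA,
    lowerBound_tiltMean A P β M hm]
  have h1 : A / P * tiltMean m = 1 := by
    rw [hPdef]
    field_simp
  have h2 : Real.log (1 / M + (1 + β * P) / P)
      = Real.log (1 + (P / M + β * P)) - Real.log P := by
    rw [← Real.log_div (by positivity) hP.ne']
    congr 1
    field_simp
    ring
  have h3 : Real.log (tiltMass m * A / P)
      = Real.log (tiltMass m) + Real.log A - Real.log P := by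
    rw [Real.log_div (by positivity) hP.ne', Real.log_mul hZ.ne' hA.ne']
  rw [h2, h3, sub_mul, h1]
  linarith

/-! ### Monotonicity and attainment of the lower bound -/

theorem two_mul_sqrt_mul_arctan_add_log_nonneg {κ : ℝ} (hκ : 0 ≤ κ) :
    0 ≤ 2 * √κ * Real.arctan √κ⁻¹ + Real.log (1 + κ) := by
  have h1 : 0 ≤ Real.arctan √κ⁻¹ := by
    rw [Real.arctan_nonneg]
    positivity
  have h2 : 0 ≤ Real.log (1 + κ) := Real.log_nonneg (by linarith)
  positivity

/-- At a fixed power `P` the lower bound grows with `α`, that is, decreases in the tilt. -/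
theorem lowerBound_mono {A P β : ℝ} {M : ℕ} (hA : 0 < A) (hP : 0 ≤ P) (hβ : 0 < β) (hM : 1 ≤ M)
    {m₁ m₂ : ℝ} (hm₁ : 0 ≤ m₁) (h : m₁ ≤ m₂) :
    lowerBound A P β M (tiltMean m₂) ≤ lowerBound A P β M (tiltMean m₁) := by
  rw [lowerBound_tiltMean A P β M hm₁, lowerBound_tiltMean A P β M (hm₁.trans h)]
  have hent : Real.log (tiltMass m₂) + m₂ * tiltMean m₂
      ≤ Real.log (tiltMass m₁) + m₁ * tiltMean m₁ :=
    (log_tiltMass_add_le m₁ m₂).trans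
      (by gcongr; exact tiltMean_strictAnti.antitone h)
  have hgap := div_le_div_of_nonneg_left
    (two_mul_sqrt_mul_arctan_add_log_nonneg (noiseRatio_pos hA hP hβ hM).le)
    (tiltMass_pos m₂) (tiltMass_antitone h)
  linarith

theorem continuousOn_lowerBound {A β : ℝ} {M : ℕ} (hA : 0 < A) (hβ : 0 < β) (hM : 1 ≤ M) :
    ContinuousOn (fun m => lowerBound A (tiltMean m * A) β M (tiltMean m)) (Ici 0) := by
  have hM0 : (0 : ℝ) < M := by exact_mod_cast hM
  have hα := tiltMean_pos
  have hZ := tiltMass_pos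
  have hcα := continuous_tiltMean
  have hcZ := continuous_tiltMass
  have hP : ∀ m, 0 < tiltMean m * A := fun m => mul_pos (hα m) hA
  have hβP : ∀ m, 0 < β * (tiltMean m * A) := fun m => mul_pos hβ (hP m)
  have hN : ∀ m, 0 < tiltMean m * A / M + β * (tiltMean m * A) := fun m =>
    add_pos (div_pos (hP m) hM0) (hβP m)
  have hκ : ∀ m, 0 < noiseRatio A (tiltMean m * A) β M := fun m => noiseRatio_pos hA (hP m).le hβ hM
  have hcκ : Continuous fun m => noiseRatio A (tiltMean m * A) β M := by
    unfold noiseRatio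
    refine Continuous.div (by fun_prop) (by fun_prop) fun m => ?_
    have := hβP m
    positivity
  refine ContinuousOn.congr (Continuous.continuousOn ?_) fun m hm =>
    lowerBound_tiltMean A (tiltMean m * A) β M hm
  have c1 : Continuous fun m => Real.log (tiltMass m) := hcZ.log fun m => (hZ m).ne'
  have c2 : Continuous fun m => √(noiseRatio A (tiltMean m * A) β M)⁻¹ :=
    Real.continuous_sqrt.comp (hcκ.inv₀ fun m => (hκ m).ne')
  have c3 : Continuous fun m => Real.log (1 + noiseRatio A (tiltMean m * A) β M) :=
    Continuous.log (by fun_prop) fun m => by have := hκ m; positivity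
  have c4 : Continuous fun m =>
      Real.log (1 / M + (1 + β * (tiltMean m * A)) / (tiltMean m * A)) := by
    refine Continuous.log (continuous_const.add (Continuous.div (by fun_prop) (by fun_prop)
      fun m => (hP m).ne')) fun m => ?_
    have := hβP m
    have := hP m
    positivity
  have c5 : Continuous fun m => Real.log ((2 * (β * (tiltMean m * A)) + 1) / M) :=
    Continuous.log (by fun_prop) fun m => by have := hβP m; positivity
  have c6 : Continuous fun m =>
      Real.log (1 + 1 / (tiltMean m * A / M + β * (tiltMean m * A))) := by
    refine Continuous.log (continuous_const.add (Continuous.div (by fun_prop) (by fun_prop)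
      fun m => (hN m).ne')) fun m => ?_
    have := hN m
    positivity
  have c7 : Continuous fun m =>
      (2 * √(noiseRatio A (tiltMean m * A) β M) * Real.arctan √(noiseRatio A (tiltMean m * A) β M)⁻¹
        + Real.log (1 + noiseRatio A (tiltMean m * A) β M)) / tiltMass m :=
    Continuous.div (((continuous_const.mul (Real.continuous_sqrt.comp hcκ)).mul
      (Real.continuous_arctan.comp c2)).add c3) hcZ fun m => (hZ m).ne'
  fun_prop

theorem le_noiseRatio {A P β : ℝ} {M : ℕ} (hA : 0 < A) (hP : 0 ≤ P) (hβ : 0 < β) :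
    M / (12 * A) ≤ noiseRatio A P β M := by
  unfold noiseRatio
  have h0 : 0 ≤ β * P := by positivity
  rw [div_le_div_iff₀ (by positivity) (by positivity)]
  have h1 : 2 * (β * P) + 1 ≤ 12 * (β * P) * (β * P + 1) + 1 := by nlinarith [mul_nonneg h0 h0]
  have h2 : (M : ℝ) * (12 * A) * (2 * (β * P) + 1)
      ≤ M * (12 * A) * (12 * (β * P) * (β * P + 1) + 1) := by gcongr
  linarith

/-- As `m → ∞` the power vanishes and the terms in its logarithm grow like `log m`, but the loss
term, whose denominator `tiltMass m` is `O(1 / √m)`, grows like `√m`. -/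
theorem exists_lowerBound_le {A β : ℝ} {M : ℕ} (hA : 0 < A) (hβ : 0 < β) (hM : 1 ≤ M) :
    ∃ C c : ℝ, 0 < c ∧ ∀ m, 1 ≤ m →
      lowerBound A (tiltMean m * A) β M (tiltMean m) ≤ C - c * √m := by
  have hM0 : (0 : ℝ) < M := by exact_mod_cast hM
  set g := Real.log (1 + M / (12 * A)) with hg
  have hg0 : 0 < g := Real.log_pos (by
    have : (0 : ℝ) < M / (12 * A) := by positivity
    linarith)
  set c := g / (2 * √Real.pi) with hc
  have hπ : 0 < √Real.pi := Real.sqrt_pos.2 Real.pi_pos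
  have hc0 : 0 < c := by positivity
  set D : ℝ := 2 * (1 / M + β) + 4 / (A * (2 / 3 * Real.exp (-1))) with hD
  have hD0 : 0 < D := by positivity
  -- `ε` is small enough that `3 log √m`, bounded by a multiple of `ε √m`, absorbs half of `c √m`
  set ε := c / 6 with hε
  have hε0 : 0 < ε := by positivity
  refine ⟨1 / 2 * Real.log A + 1 / 2 + Real.log D + 3 * (-1 - Real.log ε)
    - 1 / 2 * Real.log (2 * Real.pi * Real.exp 1) + 1 / 2 * Real.log M, c / 2, by positivity,
    fun m hm => ?_⟩
  have hm0 : 0 < m := by linarith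
  have hs1 : 1 ≤ √m := Real.one_le_sqrt.2 hm
  have hs0 : 0 < √m := by linarith
  have hα := tiltMean_pos m
  have hZ := tiltMass_pos m
  set P := tiltMean m * A with hPdef
  have hP : 0 < P := mul_pos hα hA
  have hN0 : 0 < P / M + β * P := by positivity
  rw [lowerBound_tiltMean A P β M hm0.le]
  have b1 : m * tiltMean m ≤ 1 / 2 := by
    have h := (lt_div_iff₀ (by positivity)).1 (tiltMean_lt hm0)
    linarith
  have b2 : (P / M + β * P) * Real.log (1 + 1 / (P / M + β * P)) ≤ 1 := by
    have h := Real.log_le_sub_one_of_pos (show 0 < 1 + 1 / (P / M + β * P) by positivity)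
    calc (P / M + β * P) * Real.log (1 + 1 / (P / M + β * P))
        ≤ (P / M + β * P) * (1 / (P / M + β * P)) := by
          gcongr
          linarith
      _ = 1 := by field_simp
  have b3 : -Real.log M ≤ Real.log ((2 * (β * P) + 1) / M) := by
    rw [← Real.log_inv]
    refine Real.log_le_log (by positivity) ?_
    rw [inv_eq_one_div]
    gcongr
    have : 0 < β * P := by positivity
    linarith
  have b4 : Real.log (tiltMass m) + Real.log (1 / M + (1 + β * P) / P)
      ≤ Real.log D + 3 * Real.log (√m) := by
    rw [← Real.log_mul hZ.ne' (by positivity)]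
    have hpow : 3 * Real.log (√m) = Real.log (√m ^ 3) := by
      rw [Real.log_pow]
      norm_num
    rw [hpow, ← Real.log_mul hD0.ne' (by positivity)]
    refine Real.log_le_log (by positivity) ?_
    have hmom := le_tiltMoment hm
    have hmom0 := tiltMoment_pos m
    have hZ2 := tiltMass_le_two hm0.le
    have hinv : 1 / P = tiltMass m / (tiltMoment m * A) := by
      rw [hPdef, tiltMoment_eq]
      field_simp
    have hle : (tiltMoment m)⁻¹ ≤ √m ^ 3 / (2 / 3 * Real.exp (-1)) := by
      refine (inv_anti₀ (by positivity) hmom).trans_eq ?_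
      field_simp
    have hs3 : 1 ≤ √m ^ 3 := one_le_pow₀ hs1
    calc tiltMass m * (1 / M + (1 + β * P) / P)
        = tiltMass m * (1 / M + β) + tiltMass m ^ 2 / A * (tiltMoment m)⁻¹ := by
          rw [add_div, hinv]
          field_simp
          ring
      _ ≤ 2 * (1 / M + β) + 2 ^ 2 / A * (√m ^ 3 / (2 / 3 * Real.exp (-1))) := by gcongr
      _ ≤ 2 * (1 / M + β) * √m ^ 3 + 2 ^ 2 / A * (√m ^ 3 / (2 / 3 * Real.exp (-1))) := by
          have : 0 ≤ 2 * (1 / (M : ℝ) + β) := by positivity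
          nlinarith
      _ = D * √m ^ 3 := by
          rw [hD]
          field_simp
          ring
  have b5 : Real.log (√m) ≤ ε * √m - 1 - Real.log ε := by
    have h := Real.log_le_sub_one_of_pos (show 0 < ε * √m by positivity)
    rw [Real.log_mul hε0.ne' hs0.ne'] at h
    linarith
  have b6 : c * √m ≤ (2 * √(noiseRatio A P β M) * Real.arctan √(noiseRatio A P β M)⁻¹
          + Real.log (1 + noiseRatio A P β M)) / tiltMass m := by
    have hZle := tiltMass_le_sqrt hm0
    rw [Real.sqrt_div Real.pi_pos.le] at hZle
    have hκ := le_noiseRatio (M := M) hA hP.le hβ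
    have hgle : g ≤ 2 * √(noiseRatio A P β M) * Real.arctan √(noiseRatio A P β M)⁻¹
          + Real.log (1 + noiseRatio A P β M) := by
      have h1 : 0 ≤ Real.arctan √(noiseRatio A P β M)⁻¹ := by
        rw [Real.arctan_nonneg]
        positivity
      have h2 : g ≤ Real.log (1 + noiseRatio A P β M) :=
        Real.log_le_log (by positivity) (by linarith)
      have h3 : 0 ≤ 2 * √(noiseRatio A P β M) * Real.arctan √(noiseRatio A P β M)⁻¹ := by
        positivity
      linarith
    calc c * √m = g / (2 * (√Real.pi / √m)) := by
          rw [hc]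
          field_simp
      _ ≤ g / tiltMass m := by gcongr
      _ ≤ _ := by gcongr
  have hεc : 3 * (ε * √m) = c / 2 * √m := by
    rw [hε]
    ring
  linarith

theorem exists_isMaxOn_lowerBound {A β : ℝ} {M : ℕ} (hA : 0 < A) (hβ : 0 < β) (hM : 1 ≤ M)
    {m₀ : ℝ} (hm₀ : 0 ≤ m₀) :
    ∃ m, m₀ ≤ m ∧ ∀ m', m₀ ≤ m' → lowerBound A (tiltMean m' * A) β M (tiltMean m')
      ≤ lowerBound A (tiltMean m * A) β M (tiltMean m) := by
  set h : ℝ → ℝ := fun m => lowerBound A (tiltMean m * A) β M (tiltMean m) with hh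
  obtain ⟨C, c, hc, hC⟩ := exists_lowerBound_le hA hβ hM
  have hev : ∀ᶠ m in Filter.atTop, h m ≤ h m₀ := by
    have ht : Filter.Tendsto (fun m : ℝ => C - c * √m) Filter.atTop Filter.atBot :=
      Filter.tendsto_atBot_add_const_left _ C
        (Filter.tendsto_neg_atTop_atBot.comp (Real.tendsto_sqrt_atTop.const_mul_atTop hc))
    filter_upwards [ht.eventually_le_atBot (h m₀), Filter.eventually_ge_atTop 1] with m h1 h2
    exact (hC m h2).trans h1
  obtain ⟨T, hT⟩ := Filter.eventually_atTop.1 hev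
  obtain ⟨m, hm, hmax⟩ := isCompact_Icc.exists_isMaxOn
    (nonempty_Icc.2 (le_max_left m₀ T))
    ((continuousOn_lowerBound hA hβ hM).mono fun m hm => hm₀.trans hm.1)
  refine ⟨m, hm.1, fun m' hm' => ?_⟩
  rcases le_total m' (max m₀ T) with h1 | h1
  · exact hmax ⟨hm', h1⟩
  · exact (hT m' ((le_max_right _ _).trans h1)).trans (hmax ⟨le_rfl, le_max_left _ _⟩)

theorem coe_le_coe_of_ofReal_le {b : ℝ} {c : ℝ≥0∞} (h : ENNReal.ofReal b ≤ c) :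
    (b : EReal) ≤ (c : EReal) := by
  refine le_trans ?_ (EReal.coe_ennreal_le_coe_ennreal_iff.2 h)
  rw [EReal.coe_ennreal_ofReal]
  exact EReal.coe_le_coe_iff.2 (le_max_left _ _)

end OpticalCDMA

theorem theorem4 (A E β : ℝ) (M : ℕ) (hA : 0 < A) (hE : 0 < E) (hα : E / A ≤ 1 / 3)
    (hβ : 0 < β) (hM : 1 ≤ M) :
    (∀ α ∈ Set.Ioc (0 : ℝ) (E / A), ∃! m : ℝ, OpticalCDMA.IsTilt α m) ∧
    (∃ b : ℝ,
      IsGreatest ((fun α => OpticalCDMA.lowerBound A E β M α) '' Set.Ioc (0 : ℝ) (E / A)) b ∧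
        (b : EReal) ≤ (OpticalCDMA.capacity A E β M : EReal)) ∧
    (∃ b : ℝ,
      IsGreatest ((fun α => OpticalCDMA.lowerBound A (α * A) β M α) '' Set.Ioc (0 : ℝ) (E / A)) b ∧
        (b : EReal) ≤ (OpticalCDMA.capacity A E β M : EReal)) := by
  have hEA : 0 < E / A := div_pos hE hA
  obtain ⟨m₀, hm₀, hmean₀⟩ := OpticalCDMA.exists_tiltMean_eq hEA hα
  have hle : ∀ m, OpticalCDMA.tiltMean m ≤ E / A ↔ m₀ ≤ m := fun m => by
    rw [← hmean₀, OpticalCDMA.tiltMean_strictAnti.le_iff_ge]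
  -- every admissible `α` is the mean of a tilted density whose parameter is at least `m₀`
  have hparam : ∀ α ∈ Set.Ioc (0 : ℝ) (E / A), ∃ m, m₀ ≤ m ∧ OpticalCDMA.tiltMean m = α := by
    rintro α ⟨h0, h1⟩
    obtain ⟨m, -, rfl⟩ := OpticalCDMA.exists_tiltMean_eq h0 (h1.trans hα)
    exact ⟨m, (hle m).1 h1, rfl⟩
  refine ⟨fun α h => OpticalCDMA.existsUnique_isTilt h.1 (h.2.trans hα), ?_, ?_⟩
  · refine ⟨OpticalCDMA.lowerBound A E β M (E / A), ⟨⟨E / A, ⟨hEA, le_rfl⟩, rfl⟩, ?_⟩, ?_⟩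
    · rintro _ ⟨α, hα', rfl⟩
      obtain ⟨m, hm, rfl⟩ := hparam α hα'
      dsimp only
      rw [← hmean₀]
      exact OpticalCDMA.lowerBound_mono hA hE.le hβ hM hm₀ hm
    · have hmul : OpticalCDMA.tiltMean m₀ * A = E := by
        rw [hmean₀, div_mul_cancel₀ _ hA.ne']
      have h := OpticalCDMA.ofReal_lowerBound_le_capacity hA hβ hM hm₀ hmul.le
      rw [hmul, hmean₀] at h
      exact OpticalCDMA.coe_le_coe_of_ofReal_le h
  · obtain ⟨m, hm, hmax⟩ := OpticalCDMA.exists_isMaxOn_lowerBound hA hβ hM hm₀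
    refine ⟨_, ⟨⟨OpticalCDMA.tiltMean m, ⟨OpticalCDMA.tiltMean_pos m, (hle m).2 hm⟩, rfl⟩, ?_⟩,
      ?_⟩
    · rintro _ ⟨α, hα', rfl⟩
      obtain ⟨m', hm', rfl⟩ := hparam α hα'
      exact hmax m' hm'
    · exact OpticalCDMA.coe_le_coe_of_ofReal_le (OpticalCDMA.ofReal_lowerBound_le_capacity hA hβ hM
        (hm₀.trans hm) ((le_div_iff₀ hA).1 ((hle m).2 hm)))
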